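/- Let $\mathrm{Bir}(\mathbb{P}^2)$ be the Cremona group, i.e. the group (under composition) of birational self-maps $f=(f_0:f_1:f_2)$ of the complex projective plane, where $f_0,f_1,f_2\in\mathbb{C}[x_0,x_1,x_2]$ are homogeneous of the same degree. A rational vector field on $\mathbb{P}^2$ is a $\mathbb{C}$-derivation $\chi$ of the field $\mathbb{C}(\mathbb{P}^2)$ of rational functions, and its direct image $f_*\chi$ under $f\in\mathrm{Bir}(\mathbb{P}^2)$ is the rational vector field determined by $(f_*\chi)(\varphi)\circ f=\chi(\varphi\circ f)$ for all $\varphi\in\mathbb{C}(\mathbb{P}^2)$. A foliation on $\mathbb{P}^2$ is given by a homogeneous $1$-form $\omega=F_0\,dx_0+F_1\,dx_1+F_2\,dx_2$, where the $F_i$ are homogeneous polynomials of the same degree $\nu+1$ ($\nu\ge 0$) with $\gcd(F_0,F_1,F_2)=1$ and $x_0F_0+x_1F_1+x_2F_2=0$; it is preserved by $f\in\mathrm{Bir}(\mathbb{P}^2)$ if $f^*\omega\wedge\omega=0$, and it is the foliation defined by a nonzero rational vector field $\chi$ if $\omega$ vanishes on $\chi$. Let $G$ be an uncountable abelian subgroup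 of $\mathrm{Bir}(\mathbb{P}^2)$. Then there is a nonzero rational vector field $\chi$ on $\mathbb{P}^2$ such that $$f_*\chi=\chi\qquad\text{for all } f\in G.$$ In particular $G$ preserves a foliation on $\mathbb{P}^2$: there is a foliation defined by $\chi$ that every $f\in G$ preserves. -/

import Mathlib

noncomputable section

namespace CremonaPlane

open MvPolynomial

/-! ### Birational maps of the plane in homogeneous coordinates -/

/-- The homogeneous coordinate ring `ℂ[x₀, x₁, x₂]` of the complex projective plane. -/
abbrev Poly : Type := MvPolynomial (Fin 3) ℂ

/-- The field of fractions `ℂ(x₀, x₁, x₂)`. -/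
abbrev RatFun : Type := FractionRing Poly

/-- The composition of the rational maps given by `F` and `G` is the identity:
`F ∘ G = (q x₀ : q x₁ : q x₂)` for some nonzero polynomial `q`. -/
def IsRightInverse (F G : Fin 3 → Poly) : Prop :=
  ∃ q : Poly, q ≠ 0 ∧ ∀ i, bind₁ G (F i) = q * X i

/-- A triple `(f₀ : f₁ : f₂)` of homogeneous polynomials of the same degree which represents
a birational self-map of the plane: there is a triple of homogeneous polynomials of the same
degree which represents an inverse rational map. Common factors are allowed; they disappear
when one passes to proportionality classes. -/
structure BirationalTriple where
  coord : Fin 3 → Poly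
  degree : ℕ
  homogeneous : ∀ i, (coord i).IsHomogeneous degree
  exists_inverse : ∃ (G : Fin 3 → Poly) (e : ℕ), (∀ i, (G i).IsHomogeneous e) ∧
    IsRightInverse coord G ∧ IsRightInverse G coord

theorem bind_smul {P : Poly} {d : ℕ} (hP : P.IsHomogeneous d) (c : Poly) (G : Fin 3 → Poly) :
    bind₁ (fun i => c * G i) P = c ^ d * bind₁ G P := by
  rw [P.as_sum]
  simp only [map_sum, Finset.mul_sum]
  refine Finset.sum_congr rfl fun m hm => ?_
  have hd := hP (mem_support_iff.mp hm)
  rw [bind₁_monomial, bind₁_monomial]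
  simp only [mul_pow, Finset.prod_mul_distrib]
  rw [Finset.prod_pow_eq_pow_sum]
  have : ∑ i ∈ m.support, m i = d := by
    rw [← hd]
    simp [Finsupp.weight_apply, Finsupp.sum]
  rw [this]
  ring

theorem bind_bind (F G : Fin 3 → Poly) (P : Poly) :
    bind₁ G (bind₁ F P) = bind₁ (fun i => bind₁ G (F i)) P := bind₁_bind₁ _ _ _

theorem isHomogeneous_bind {P : Poly} {d e : ℕ} (hP : P.IsHomogeneous d) {G : Fin 3 → Poly}
    (hG : ∀ i, (G i).IsHomogeneous e) : (bind₁ G P).IsHomogeneous (e * d) :=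
  hP.aeval G hG

theorem coord_ne_zero {F G : Fin 3 → Poly} (h : IsRightInverse F G) (i : Fin 3) :
    F i ≠ 0 := by
  intro h0
  obtain ⟨q, hq, h⟩ := h
  have := h i
  rw [h0, map_zero] at this
  exact mul_ne_zero hq (X_ne_zero i) this.symm

/-- Substituting an invertible homogeneous triple into polynomials is injective. -/
theorem bind_injective {F G : Fin 3 → Poly} {d e : ℕ} (hF : ∀ i, (F i).IsHomogeneous d)
    (hG : ∀ i, (G i).IsHomogeneous e) (h : IsRightInverse F G) :
    Function.Injective (bind₁ F : Poly →ₐ[ℂ] Poly) := by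
  obtain ⟨q, hq, h⟩ := h
  have hN : (q * X 0 : Poly).IsHomogeneous (e * d) := by
    rw [← h 0]; exact isHomogeneous_bind (hF 0) hG
  have hcoef : ∀ m, coeff m q ≠ 0 → m.degree + 1 = e * d := by
    intro m hm
    have h1 : coeff (m + Finsupp.single 0 1) (q * X 0 : Poly) ≠ 0 := by
      rwa [coeff_mul_X]
    have h2 := hN h1
    have h3 : (m + Finsupp.single 0 1).degree = e * d := by
      rw [Finsupp.degree_eq_weight_one]; exact h2
    simpa using h3
  obtain ⟨m, hm⟩ := ne_zero_iff.mp hq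
  have hqh : q.IsHomogeneous m.degree := by
    intro m' hm'
    have h1 := hcoef m hm
    have h2 := hcoef m' hm'
    have h3 : m'.degree = m.degree := by omega
    rw [← h3, Finsupp.degree_eq_weight_one]; rfl
  rw [injective_iff_map_eq_zero]
  intro P hP
  have h0 : bind₁ (fun i => q * X i) P = 0 := by
    have : bind₁ G (bind₁ F P) = 0 := by rw [hP, map_zero]
    rw [bind_bind] at this
    simpa only [h] using this
  have hX : ∀ Q : Poly, bind₁ (X : Fin 3 → Poly) Q = Q := fun Q => by
    rw [bind₁, aeval_X_left]; rfl
  have hcomp : ∀ k, bind₁ (fun i => q * X i) (homogeneousComponent k P)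
      = q ^ k * homogeneousComponent k P := fun k => by
    rw [bind_smul (homogeneousComponent_isHomogeneous k P), hX]
  have hsum : ∑ k ∈ Finset.range (P.totalDegree + 1), q ^ k * homogeneousComponent k P = 0 := by
    rw [← h0]
    conv_rhs => rw [← sum_homogeneousComponent P]
    rw [map_sum]
    exact Finset.sum_congr rfl fun k _ => (hcomp k).symm
  have hhom : ∀ k, (q ^ k * homogeneousComponent k P).IsHomogeneous (m.degree * k + k) :=
    fun k => (hqh.pow k).mul (homogeneousComponent_isHomogeneous k P)
  have hz : ∀ k ∈ Finset.range (P.totalDegree + 1), homogeneousComponent k P = 0 := by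
    intro k hk
    have h1 := congrArg (homogeneousComponent (m.degree * k + k)) hsum
    rw [map_sum, map_zero, Finset.sum_eq_single k] at h1
    · rw [homogeneousComponent_of_mem (hhom k), if_pos rfl] at h1
      exact (mul_eq_zero.mp h1).resolve_left (pow_ne_zero _ hq)
    · intro b _ hb
      rw [homogeneousComponent_of_mem (hhom b), if_neg]
      intro hc
      apply hb
      have : (m.degree + 1) * k = (m.degree + 1) * b := by linarith
      exact (Nat.eq_of_mul_eq_mul_left (Nat.succ_pos _) this).symm
    · intro hk'; exact absurd hk hk'
  rw [← sum_homogeneousComponent P]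
  exact Finset.sum_eq_zero hz

theorem isRightInverse_comp {F G F' G' : Fin 3 → Poly} {d : ℕ}
    (hF : ∀ i, (F i).IsHomogeneous d)
    (hinj : Function.Injective (bind₁ F' : Poly →ₐ[ℂ] Poly))
    (h : IsRightInverse F F') (h' : IsRightInverse G G') :
    IsRightInverse (fun i => bind₁ G (F i)) (fun i => bind₁ F' (G' i)) := by
  obtain ⟨q, hq, h⟩ := h
  obtain ⟨q', hq', h'⟩ := h'
  refine ⟨(bind₁ F' q') ^ d * q, mul_ne_zero (pow_ne_zero _ ?_) hq, fun i => ?_⟩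
  · intro h0
    exact hq' (hinj (by rw [h0, map_zero]))
  · have : bind₁ (fun i => bind₁ F' (G' i)) (bind₁ G (F i))
        = bind₁ (fun j => bind₁ F' q' * F' j) (F i) := by
      rw [bind_bind]
      congr 2
      funext j
      rw [← bind_bind, h', map_mul, bind₁_X_right]
    rw [this, bind_smul (hF i), h]
    ring

namespace BirationalTriple

theorem coord_ne (F : BirationalTriple) (i : Fin 3) : F.coord i ≠ 0 := by
  obtain ⟨G, -, -, h, -⟩ := F.exists_inverse
  exact coord_ne_zero h i

theorem injective (F : BirationalTriple) :
    Function.Injective (bind₁ F.coord : Poly →ₐ[ℂ] Poly) := by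
  obtain ⟨G, e, hG, h, -⟩ := F.exists_inverse
  exact bind_injective F.homogeneous hG h

/-- Two triples define the same rational map when they are proportional. -/
instance setoid : Setoid BirationalTriple where
  r F G := ∀ i j, F.coord i * G.coord j = F.coord j * G.coord i
  iseqv :=
    { refl := fun F i j => mul_comm _ _
      symm := fun {F G} h i j => by linear_combination h j i
      trans := fun {F G H} h h' i j => by
        apply mul_left_cancel₀ (G.coord_ne 0)
        linear_combination H.coord j * h i 0 - H.coord i * h j 0
          + F.coord 0 * h' i j }

/-- The identity `(x₀ : x₁ : x₂)`. -/
def one : BirationalTriple where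
  coord := X
  degree := 1
  homogeneous := fun i => isHomogeneous_X ℂ i
  exists_inverse := ⟨X, 1, fun i => isHomogeneous_X ℂ i, ⟨1, one_ne_zero, fun i => by simp⟩,
    ⟨1, one_ne_zero, fun i => by simp⟩⟩

/-- The composition `F ∘ G = (f₀(g₀, g₁, g₂) : f₁(g₀, g₁, g₂) : f₂(g₀, g₁, g₂))`. -/
def comp (F G : BirationalTriple) : BirationalTriple where
  coord := fun i => bind₁ G.coord (F.coord i)
  degree := G.degree * F.degree
  homogeneous := fun i => isHomogeneous_bind (F.homogeneous i) G.homogeneous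
  exists_inverse := by
    obtain ⟨F', d', hF', h1, h2⟩ := F.exists_inverse
    obtain ⟨G', e', hG', h3, h4⟩ := G.exists_inverse
    exact ⟨fun i => bind₁ F' (G' i), d' * e', fun i => isHomogeneous_bind (hG' i) hF',
      isRightInverse_comp F.homogeneous (bind_injective hF' F.homogeneous h2) h1 h3,
      isRightInverse_comp hG' G.injective h4 h2⟩

theorem pow_mul_bind {P : Poly} {n : ℕ} (hP : P.IsHomogeneous n) {F G : BirationalTriple}
    (h : F ≈ G) :
    G.coord 0 ^ n * bind₁ F.coord P = F.coord 0 ^ n * bind₁ G.coord P := by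
  rw [← bind_smul hP, ← bind_smul hP]
  congr 2
  funext i
  have : F.coord i * G.coord 0 = F.coord 0 * G.coord i := h i 0
  linear_combination this

theorem comp_congr {F F' G G' : BirationalTriple} (hF : F ≈ F') (hG : G ≈ G') :
    F.comp G ≈ F'.comp G' := by
  intro i j
  change bind₁ G.coord (F.coord i) * bind₁ G'.coord (F'.coord j)
    = bind₁ G.coord (F.coord j) * bind₁ G'.coord (F'.coord i)
  apply mul_left_cancel₀ (pow_ne_zero F.degree (G'.coord_ne 0))
  have h1 := pow_mul_bind (F.homogeneous i) hG
  have h2 := pow_mul_bind (F.homogeneous j) hG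
  have h3 : bind₁ G'.coord (F.coord i) * bind₁ G'.coord (F'.coord j)
      = bind₁ G'.coord (F.coord j) * bind₁ G'.coord (F'.coord i) := by
    rw [← map_mul, ← map_mul, hF i j]
  linear_combination bind₁ G'.coord (F'.coord j) * h1 - bind₁ G'.coord (F'.coord i) * h2
    + G.coord 0 ^ F.degree * h3

theorem eq_of_coord {F G : BirationalTriple} (h : ∀ i, F.coord i = G.coord i)
    (h' : F.degree = G.degree) : F = G := by
  cases F
  cases G
  obtain rfl := funext h
  obtain rfl := h'
  rfl

theorem comp_assoc (F G H : BirationalTriple) : (F.comp G).comp H = F.comp (G.comp H) := by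
  refine eq_of_coord (fun i => ?_) (Nat.mul_assoc H.degree G.degree F.degree).symm
  exact bind_bind G.coord H.coord (F.coord i)

theorem one_comp (F : BirationalTriple) : one.comp F = F := by
  cases F
  simp [comp, one]

end BirationalTriple

/-! ### The Cremona group -/

/-- The Cremona group `Bir(ℙ²)`: birational triples up to proportionality, under composition. -/
def Cremona : Type := Quotient BirationalTriple.setoid

namespace Cremona

/-- The birational map `(f₀ : f₁ : f₂)`. -/
def mk (F : BirationalTriple) : Cremona := Quotient.mk _ F

instance : One Cremona := ⟨mk BirationalTriple.one⟩

/-- The group law is composition: `f * g = f ∘ g`. -/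
instance : Mul Cremona :=
  ⟨Quotient.map₂ BirationalTriple.comp fun _ _ hF _ _ hG => BirationalTriple.comp_congr hF hG⟩

theorem exists_left_inv (f : Cremona) : ∃ g : Cremona, g * f = 1 := by
  obtain ⟨F⟩ := f
  obtain ⟨G, e, hG, h1, h2⟩ := F.exists_inverse
  refine ⟨mk ⟨G, e, hG, F.coord, F.degree, F.homogeneous, h2, h1⟩, Quotient.sound ?_⟩
  obtain ⟨q, -, hq⟩ := h2
  intro i j
  change bind₁ F.coord (G i) * X j = bind₁ F.coord (G j) * X i
  rw [hq, hq]
  ring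

instance : Inv Cremona := ⟨fun f => (exists_left_inv f).choose⟩

theorem mk_mul (F G : BirationalTriple) : mk F * mk G = mk (F.comp G) := rfl

theorem mul_assoc' (f g h : Cremona) : f * g * h = f * (g * h) := by
  induction f using Quotient.inductionOn with | _ F
  induction g using Quotient.inductionOn with | _ G
  induction h using Quotient.inductionOn with | _ H
  exact congrArg mk (BirationalTriple.comp_assoc F G H)

theorem one_mul' (f : Cremona) : 1 * f = f := by
  induction f using Quotient.inductionOn with | _ F
  exact congrArg mk (BirationalTriple.one_comp F)

instance : Group Cremona :=
  Group.ofLeftAxioms mul_assoc' one_mul' fun f => (exists_left_inv f).choose_spec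

end Cremona

/-! ### Rational functions and rational vector fields on the plane -/

/-- The field of rational functions on the plane: the quotients `A / B` of homogeneous
polynomials of the same degree. -/
def functionField : IntermediateField ℂ RatFun where
  carrier := {a | ∃ (n : ℕ) (A B : Poly), A.IsHomogeneous n ∧ B.IsHomogeneous n ∧ B ≠ 0 ∧
    a = algebraMap Poly RatFun A / algebraMap Poly RatFun B}
  mul_mem' := by
    rintro _ _ ⟨n, A, B, hA, hB, h0, rfl⟩ ⟨n', A', B', hA', hB', h0', rfl⟩
    exact ⟨n + n', A * A', B * B', hA.mul hA', hB.mul hB', mul_ne_zero h0 h0', by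
      rw [map_mul, map_mul, div_mul_div_comm]⟩
  add_mem' := by
    rintro _ _ ⟨n, A, B, hA, hB, h0, rfl⟩ ⟨n', A', B', hA', hB', h0', rfl⟩
    refine ⟨n + n', A * B' + B * A', B * B', (hA.mul hB').add (hB.mul hA'), hB.mul hB',
      mul_ne_zero h0 h0', ?_⟩
    rw [div_add_div _ _ (by simpa using h0) (by simpa using h0')]
    simp only [map_mul, map_add]
  algebraMap_mem' := fun c => ⟨0, C c, 1, isHomogeneous_C _ c, isHomogeneous_one _ _, one_ne_zero,
    by rw [map_one, div_one, ← MvPolynomial.algebraMap_eq, ← IsScalarTower.algebraMap_apply]⟩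
  inv_mem' := by
    rintro _ ⟨n, A, B, hA, hB, h0, rfl⟩
    by_cases hA0 : A = 0
    · exact ⟨0, 0, 1, isHomogeneous_zero _ _ _, isHomogeneous_one _ _, one_ne_zero, by simp [hA0]⟩
    · exact ⟨n, B, A, hB, hA, hA0, by rw [inv_div]⟩

/-- A rational vector field on the plane, that is, a `ℂ`-derivation of its field of rational
functions. -/
abbrev RationalVectorField : Type := Derivation ℂ functionField functionField

theorem ratio_mem (i j : Fin 3) :
    algebraMap Poly RatFun (X i) / algebraMap Poly RatFun (X j) ∈ functionField :=
  ⟨1, X i, X j, isHomogeneous_X _ _, isHomogeneous_X _ _, X_ne_zero j, rfl⟩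

/-- The rational function `xᵢ / xⱼ`. -/
def ratio (i j : Fin 3) : functionField := ⟨_, ratio_mem i j⟩

namespace BirationalTriple

theorem injective_algHom (F : BirationalTriple) :
    Function.Injective ((Algebra.algHom ℂ Poly RatFun).comp (bind₁ F.coord)) := by
  intro A B h
  exact F.injective (IsFractionRing.injective Poly RatFun h)

/-- The substitution of `F` into a rational function in three variables. -/
def subst (F : BirationalTriple) : RatFun →ₐ[ℂ] RatFun :=
  IsFractionRing.liftAlgHom F.injective_algHom

theorem subst_algebraMap (F : BirationalTriple) (A : Poly) :
    F.subst (algebraMap Poly RatFun A) = algebraMap Poly RatFun (bind₁ F.coord A) :=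
  IsFractionRing.lift_algebraMap F.injective_algHom A

theorem subst_mem (F : BirationalTriple) {a : RatFun} (ha : a ∈ functionField) :
    F.subst a ∈ functionField := by
  obtain ⟨n, A, B, hA, hB, h0, rfl⟩ := ha
  refine ⟨_, _, _, isHomogeneous_bind hA F.homogeneous, isHomogeneous_bind hB F.homogeneous,
    fun h => h0 (F.injective (by rw [h, map_zero])), ?_⟩
  rw [map_div₀, subst_algebraMap, subst_algebraMap]

/-- The composition `φ ↦ φ ∘ F` on rational functions on the plane. -/
def pullback (F : BirationalTriple) : functionField →ₐ[ℂ] functionField :=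
  (F.subst.comp functionField.val).codRestrict functionField.toSubalgebra
    fun a => F.subst_mem a.2

theorem coe_pullback (F : BirationalTriple) (a : functionField) :
    (F.pullback a : RatFun) = F.subst a := rfl

theorem pullback_congr {F G : BirationalTriple} (h : F ≈ G) : F.pullback = G.pullback := by
  ext ⟨_, n, A, B, hA, hB, h0, rfl⟩
  rw [coe_pullback, coe_pullback]
  simp only [map_div₀, subst_algebraMap]
  have h1 : bind₁ F.coord B ≠ 0 := fun h => h0 (F.injective (by rw [h, map_zero]))
  have h2 : bind₁ G.coord B ≠ 0 := fun h => h0 (G.injective (by rw [h, map_zero]))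
  rw [div_eq_div_iff (by simpa using h1) (by simpa using h2), ← map_mul, ← map_mul]
  congr 1
  apply mul_left_cancel₀ (pow_ne_zero n (G.coord_ne 0))
  linear_combination bind₁ G.coord B * pow_mul_bind hA h - bind₁ G.coord A * pow_mul_bind hB h

theorem pullback_comp (F G : BirationalTriple) :
    (F.comp G).pullback = G.pullback.comp F.pullback := by
  ext ⟨_, n, A, B, hA, hB, h0, rfl⟩
  simp only [AlgHom.comp_apply, coe_pullback, map_div₀, subst_algebraMap, bind_bind, comp]

theorem pullback_one : one.pullback = AlgHom.id ℂ functionField := by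
  ext ⟨_, n, A, B, hA, hB, h0, rfl⟩
  simp only [AlgHom.id_apply, coe_pullback, map_div₀, subst_algebraMap, one, bind₁,
    aeval_X_left]

end BirationalTriple

namespace Cremona

/-- The composition `f^* φ = φ ∘ f` on rational functions on the plane. -/
def pullbackHom (f : Cremona) : functionField →ₐ[ℂ] functionField :=
  Quotient.lift BirationalTriple.pullback (fun _ _ h => BirationalTriple.pullback_congr h) f

theorem pullbackHom_mul (f g : Cremona) :
    (f * g).pullbackHom = g.pullbackHom.comp f.pullbackHom := by
  obtain ⟨F⟩ := f
  obtain ⟨G⟩ := g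
  exact BirationalTriple.pullback_comp F G

theorem pullbackHom_one : (1 : Cremona).pullbackHom = AlgHom.id ℂ functionField :=
  BirationalTriple.pullback_one

/-- The automorphism `φ ↦ φ ∘ f` of the field of rational functions. -/
def pullback (f : Cremona) : functionField ≃ₐ[ℂ] functionField :=
  AlgEquiv.ofAlgHom f.pullbackHom f⁻¹.pullbackHom
    (by rw [← pullbackHom_mul, inv_mul_cancel, pullbackHom_one])
    (by rw [← pullbackHom_mul, mul_inv_cancel, pullbackHom_one])

/-- The direct image `f_* χ`, determined by `(f_* χ)(φ) ∘ f = χ(φ ∘ f)`. -/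
def pushforward (f : Cremona) (χ : RationalVectorField) : RationalVectorField :=
  Derivation.mk' (f.pullback.symm.toLinearMap ∘ₗ χ.toLinearMap ∘ₗ f.pullback.toLinearMap)
    (fun a b => by simp)

end Cremona

/-! ### Foliations of the plane -/

/-- A foliation of the plane, given by a homogeneous `1`-form `ω = F₀ dx₀ + F₁ dx₁ + F₂ dx₂`
without common factor and satisfying `x₀ F₀ + x₁ F₁ + x₂ F₂ = 0`. -/
structure Foliation where
  coeff : Fin 3 → Poly
  degree : ℕ
  homogeneous : ∀ i, (coeff i).IsHomogeneous (degree + 1)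
  coprime : ∀ p : Poly, (∀ i, p ∣ coeff i) → IsUnit p
  euler : ∑ i, X i * coeff i = 0

namespace Foliation

/-- The coefficient of `dxⱼ` in the form `F^* ω = ∑ᵢ ωᵢ(F) dFᵢ`. -/
def pullbackCoeff (ω : Foliation) (F : BirationalTriple) (j : Fin 3) : Poly :=
  ∑ i, bind₁ F.coord (ω.coeff i) * pderiv j (F.coord i)

/-- The birational map `f` preserves the foliation defined by `ω`: `f^* ω ∧ ω = 0`. -/
def IsInvariant (ω : Foliation) (f : Cremona) : Prop :=
  ∀ F : BirationalTriple, Cremona.mk F = f →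
    ∀ i j, ω.pullbackCoeff F i * ω.coeff j = ω.pullbackCoeff F j * ω.coeff i

/-- The foliation is the one defined by `χ`: the form `ω` vanishes on `χ`, which reads
`∑ᵢ ωᵢ χ(xᵢ / xⱼ) = 0` in the affine chart `xⱼ ≠ 0`. -/
def IsDefinedBy (ω : Foliation) (χ : RationalVectorField) : Prop :=
  ∀ j, ∑ i, algebraMap Poly RatFun (ω.coeff i) * (χ (ratio i j) : RatFun) = 0

end Foliation

end CremonaPlane

end

noncomputable section

namespace CremonaPlane

open MvPolynomial

/-! ### Homogeneous triples without common factor -/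

/-! The vector field is a velocity: if birational maps `f_t` commute with `g`, differentiating `f_t
∘ g = g ∘ f_t` shows that `(d f_t/dt) ∘ f_t⁻¹` is invariant under `g`. No curve in the group is
needed, only one tangent direction.

Every map has a representative without common factor whose first coordinate has coefficient 1 at
some monomial `m`. There are countably many pairs (degree, `m`), so uncountably many elements of `G`
share one pair `(d, m₀)`, and their representatives lie in a finite-dimensional complex vector
space. An uncountable subset of such a space accumulates at one of its own points `F`, and its
tangent cone there contains some `H ≠ 0` (`exists_tangent_of_not_countable`). The derivative at `F`
of any function constant on the set kills `H`. Commuting with a given `g` is a system of polynomial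
equations on triples, so the single vector `H` satisfies the linearised equations for all `g ∈ G` at
once (`exists_tangent_triple`).

Calculus with `F + εH` over the dual numbers turns these equations into invariance of the field `χ`
of velocity `H` at `F` (`derivAlong_pullback`, `pushforward_tangentField`). The field could vanish
only if `H` were proportional to `F`; the absence of common factors and the normalised coefficient
exclude this (`IsReduced.not_proportional`).

The foliation is the cross product of the radial field with `χ`, divided by its gcd. If `f` fixes
`χ`, then `f^*ω` kills both fields, so it is proportional to `ω` (`mul_eq_mul_of_cross_product`). -/

/-- The substitution `Xᵢ ↦ Xᵢ T`, which separates the homogeneous components. -/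
def scaling : Poly →ₐ[ℂ] Polynomial Poly :=
  aeval fun i => Polynomial.C (X i) * Polynomial.X

theorem scaling_of_isHomogeneous {A : Poly} {n : ℕ} (hA : A.IsHomogeneous n) :
    scaling A = Polynomial.C A * Polynomial.X ^ n := by
  have h1 : scaling A = ∑ m ∈ A.support, scaling (monomial m (coeff m A)) := by
    conv_lhs => rw [A.as_sum, map_sum]
  have h2 : Polynomial.C A = ∑ m ∈ A.support, Polynomial.C (monomial m (coeff m A)) := by
    conv_lhs => rw [A.as_sum, map_sum]
  rw [h1, h2, Finset.sum_mul]
  refine Finset.sum_congr rfl fun m hm => ?_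
  have hd := hA (mem_support_iff.mp hm)
  rw [scaling, aeval_monomial, monomial_eq]
  have : m.prod (fun i k => (Polynomial.C (X i : Poly) * Polynomial.X) ^ k)
      = Polynomial.C (m.prod fun i k => (X i : Poly) ^ k) * Polynomial.X ^ n := by
    simp only [Finsupp.prod, mul_pow, Finset.prod_mul_distrib, map_prod, map_pow]
    rw [Finset.prod_pow_eq_pow_sum]
    congr 2
    rw [← hd]
    simp [Finsupp.weight_apply, Finsupp.sum]
  rw [this, map_mul, mul_assoc]
  rfl

theorem coeff_scaling (A : Poly) (k : ℕ) : (scaling A).coeff k = homogeneousComponent k A := by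
  have h1 : scaling A = ∑ j ∈ Finset.range (A.totalDegree + 1),
      Polynomial.C (homogeneousComponent j A) * Polynomial.X ^ j := by
    conv_lhs => rw [← sum_homogeneousComponent A, map_sum]
    exact Finset.sum_congr rfl fun j _ =>
      scaling_of_isHomogeneous (homogeneousComponent_isHomogeneous j A)
  rw [h1, Polynomial.finsetSum_coeff]
  simp only [Polynomial.coeff_C_mul_X_pow]
  rw [Finset.sum_ite_eq]
  split_ifs with h
  · rfl
  · rw [homogeneousComponent_eq_zero]
    simpa using h

theorem scaling_ne_zero {A : Poly} (hA : A ≠ 0) : scaling A ≠ 0 := by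
  intro h
  apply hA
  rw [← sum_homogeneousComponent A]
  exact Finset.sum_eq_zero fun k _ => by rw [← coeff_scaling, h, Polynomial.coeff_zero]

/-- A factor of a nonzero homogeneous polynomial is homogeneous. -/
theorem exists_isHomogeneous_of_mul {A B : Poly} {n : ℕ} (h : (A * B).IsHomogeneous n)
    (h0 : A * B ≠ 0) :
    ∃ k l, k + l = n ∧ A.IsHomogeneous k ∧ B.IsHomogeneous l := by
  have hA := left_ne_zero_of_mul h0
  have hB := right_ne_zero_of_mul h0
  have hprod : scaling A * scaling B = Polynomial.C (A * B) * Polynomial.X ^ n := by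
    rw [← map_mul, scaling_of_isHomogeneous h]
  have h1 := Polynomial.natDegree_mul (scaling_ne_zero hA) (scaling_ne_zero hB)
  have h2 := Polynomial.natTrailingDegree_mul (scaling_ne_zero hA) (scaling_ne_zero hB)
  rw [hprod, Polynomial.natDegree_C_mul_X_pow _ _ h0] at h1
  rw [hprod, Polynomial.C_mul_X_pow_eq_monomial, Polynomial.natTrailingDegree_monomial h0] at h2
  have h3 := Polynomial.natTrailingDegree_le_natDegree (scaling A)
  have h4 := Polynomial.natTrailingDegree_le_natDegree (scaling B)
  -- The product is a monomial in `T`, and degree and trailing degree are both additive over a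
  -- domain. So they agree for each factor, which leaves each factor a single homogeneous component.
  have key : ∀ P : Poly, (scaling P).natTrailingDegree = (scaling P).natDegree →
      P.IsHomogeneous (scaling P).natDegree := by
    intro P hP
    have : P = homogeneousComponent (scaling P).natDegree P := by
      conv_lhs => rw [← sum_homogeneousComponent P]
      by_cases hm : (scaling P).natDegree ∈ Finset.range (P.totalDegree + 1)
      · refine Finset.sum_eq_single_of_mem _ hm fun k _ hk => ?_
        rw [← coeff_scaling]
        rcases lt_or_gt_of_ne hk with h | h
        · exact Polynomial.coeff_eq_zero_of_lt_natTrailingDegree (by omega)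
        · exact Polynomial.coeff_eq_zero_of_natDegree_lt h
      · have h0 : homogeneousComponent (scaling P).natDegree P = 0 :=
          homogeneousComponent_eq_zero _ _ (by simpa using hm)
        rw [← coeff_scaling, Polynomial.coeff_natDegree, Polynomial.leadingCoeff_eq_zero] at h0
        have : P = 0 := by
          by_contra hP0
          exact scaling_ne_zero hP0 h0
        rw [sum_homogeneousComponent, this]
        simp
    have h := homogeneousComponent_isHomogeneous (scaling P).natDegree P
    rwa [← this] at h
  exact ⟨_, _, h1.symm, key A (by omega), key B (by omega)⟩

/-- The polynomials `Fᵢ` have no common factor. -/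
def IsReduced (F : Fin 3 → Poly) : Prop := ∀ p : Poly, (∀ i, p ∣ F i) → IsUnit p

theorem isReduced_X : IsReduced X := by
  intro p hp
  obtain ⟨a, ha⟩ := hp 0
  obtain ⟨b, hb⟩ := hp 1
  have h0 : Prime (X 0 : Poly) := X_prime
  have h1 : Irreducible (X 1 : Poly) := X_prime.irreducible
  rcases h1.isUnit_or_isUnit hb with h | h
  · exact h
  exfalso
  have : (X 1 : Poly) ∣ X 0 := by
    rw [hb, ha]
    exact mul_dvd_mul ((dvd_refl p)) h.dvd
  rw [X_dvd_X] at this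
  simp at this

/-- A triple proportional to a triple without common factor is a polynomial multiple of it. -/
theorem IsReduced.exists_eq_mul {F H : Fin 3 → Poly} (hF : IsReduced F)
    (h : ∀ i j, H i * F j = H j * F i) : ∃ c : Poly, ∀ i, H i = c * F i := by
  classical
  let : StrongNormalizationMonoid Poly := UniqueFactorizationMonoid.strongNormalizationMonoid
  let : StrongNormalizedGCDMonoid Poly :=
    UniqueFactorizationMonoid.toStrongNormalizedGCDMonoid Poly
  have hgcd : IsUnit (Finset.univ.gcd F) :=
    hF _ fun i => Finset.gcd_dvd (Finset.mem_univ i)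
  obtain ⟨k, hk⟩ : ∃ k, F k ≠ 0 := by
    by_contra! h0
    exact not_isUnit_zero (hF 0 fun i => by rw [h0 i])
  have hdvd : F k ∣ H k := by
    -- `F k` divides every `H k * F j = H j * F k`, hence their gcd, which is `H k` up to a unit
    -- because the gcd of the `F j` is a unit.
    have h1 : F k ∣ Finset.univ.gcd fun j => H k * F j :=
      Finset.dvd_gcd fun j _ => by rw [h k j]; exact dvd_mul_left _ _
    rw [Finset.gcd_mul_left] at h1
    have h2 := (hgcd.dvd_mul_right).mp h1
    exact dvd_normalize_iff.mp h2
  obtain ⟨c, hc⟩ := hdvd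
  refine ⟨c, fun i => mul_right_cancel₀ hk ?_⟩
  rw [h i k, hc]
  ring

/-- Dividing a homogeneous triple by a greatest common divisor. -/
theorem exists_isReduced {W : Fin 3 → Poly} {n : ℕ} (hW : ∀ i, (W i).IsHomogeneous n)
    (h0 : ∃ i, W i ≠ 0) :
    ∃ (p : Poly) (V : Fin 3 → Poly) (k l : ℕ), p ≠ 0 ∧ k + l = n ∧ p.IsHomogeneous k ∧
      (∀ i, (V i).IsHomogeneous l) ∧ (∀ i, W i = p * V i) ∧ IsReduced V := by
  classical
  let : StrongNormalizationMonoid Poly := UniqueFactorizationMonoid.strongNormalizationMonoid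
  let : StrongNormalizedGCDMonoid Poly :=
    UniqueFactorizationMonoid.toStrongNormalizedGCDMonoid Poly
  obtain ⟨V, hV, hgcd⟩ := Finset.univ.extract_gcd W Finset.univ_nonempty
  replace hV := fun i => hV i (Finset.mem_univ i)
  set p := Finset.univ.gcd W
  obtain ⟨i, hi⟩ := h0
  have hi' : p * V i ≠ 0 := by rwa [← hV i]
  obtain ⟨k, l, hkl, hp, -⟩ := exists_isHomogeneous_of_mul (hV i ▸ hW i) hi'
  have hp0 := left_ne_zero_of_mul hi'
  refine ⟨p, V, k, l, hp0, hkl, hp, fun j => ?_, hV, fun q hq => ?_⟩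
  · by_cases hj : V j = 0
    · rw [hj]; exact isHomogeneous_zero _ _ _
    · obtain ⟨k', l', hkl', hp', hl'⟩ :=
        exists_isHomogeneous_of_mul (hV j ▸ hW j) (mul_ne_zero hp0 hj)
      have := hp.inj_right hp' hp0
      rwa [show l = l' by omega]
  · rw [isUnit_iff_dvd_one, ← hgcd]
    exact Finset.dvd_gcd fun j _ => hq j

/-- Every birational map of the plane is represented by a triple without common factor. -/
theorem BirationalTriple.exists_isReduced (F : BirationalTriple) :
    ∃ F' : BirationalTriple, F' ≈ F ∧ IsReduced F'.coord := by
  obtain ⟨p, V, k, l, hp0, -, hp, hV, hFV, hred⟩ :=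
    CremonaPlane.exists_isReduced F.homogeneous ⟨0, F.coord_ne 0⟩
  obtain ⟨G, e, hG, ⟨q, hq, h1⟩, ⟨q', hq', h2⟩⟩ := F.exists_inverse
  -- Dividing by the gcd changes each composite with the inverse by a factor `a`. The quotient is
  -- still proportional to the reduced triple `X`, hence a polynomial multiple of it.
  have key : ∀ (a q : Poly) (P : Fin 3 → Poly), q ≠ 0 → (∀ i, a * P i = q * X i) →
      ∃ c : Poly, c ≠ 0 ∧ ∀ i, P i = c * X i := by
    intro a q P hq h
    have ha : a ≠ 0 := by
      rintro rfl
      have := h 0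
      rw [zero_mul] at this
      exact mul_ne_zero hq (X_ne_zero 0) this.symm
    obtain ⟨c, hc⟩ := isReduced_X.exists_eq_mul (H := P) fun i j => mul_left_cancel₀ ha (by
      linear_combination X j * h i - X i * h j)
    refine ⟨c, ?_, hc⟩
    rintro rfl
    have := h 0
    rw [hc, zero_mul, mul_zero] at this
    exact mul_ne_zero hq (X_ne_zero 0) this.symm
  refine ⟨⟨V, l, hV, G, e, hG, ?_, ?_⟩, ?_, hred⟩
  · exact key (bind₁ G p) q _ hq fun i => by rw [← map_mul, ← hFV, h1]
  · refine key (p ^ e) q' _ hq' fun i => ?_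
    rw [← bind_smul (hG i), ← h2]
    congr 2
    funext j
    exact (hFV j).symm
  · intro i j
    change V i * F.coord j = V j * F.coord i
    rw [hFV, hFV]
    ring

/-! ### Tangent vectors to uncountable families of homogeneous triples -/

/-- A set with no accumulation point in itself is discrete, hence countable by second countability.
At an accumulation point, compactness of the unit sphere gives a nonzero tangent direction. A
function constant on `S` also has derivative 0 within `S`, and the two derivatives agree on the
tangent cone. The vector `v` is chosen before `φ`, so it serves arbitrarily many equations. -/
theorem exists_tangent_of_not_countable {E : Type*} [NormedAddCommGroup E] [NormedSpace ℂ E]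
    [FiniteDimensional ℂ E] {S : Set E} (hS : ¬ S.Countable) :
    ∃ s ∈ S, ∃ v : E, v ≠ 0 ∧ ∀ (φ : E → ℂ) (φ' : E →L[ℂ] ℂ) (a : ℂ), HasFDerivAt φ φ' s →
      (∀ t ∈ S, φ t = a) → φ' v = 0 := by
  have : ProperSpace E := FiniteDimensional.proper ℂ E
  have hex : ∃ s ∈ S, AccPt s (Filter.principal S) := by
    by_contra! h
    apply hS
    have : DiscreteTopology S := by
      rw [discreteTopology_subtype_iff]
      intro x hx
      exact Filter.not_neBot.mp (h x hx)
    have : SecondCountableTopology E := secondCountable_of_proper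
    have : Countable S := TopologicalSpace.separableSpace_iff_countable.mp inferInstance
    exact Set.countable_coe_iff.mp this
  obtain ⟨s, hs, hacc⟩ := hex
  obtain ⟨v, hv, hv0⟩ := tangentConeAt_nonempty_of_properSpace (𝕜 := ℂ) hacc
  refine ⟨s, hs, v, hv0, fun φ φ' a hφ ha => ?_⟩
  have h1 : HasFDerivWithinAt φ (0 : E →L[ℂ] ℂ) S s :=
    (hasFDerivWithinAt_const a s S).congr ha (ha s hs)
  exact hφ.hasFDerivWithinAt.unique_on h1 hv

/-- The derivative of `A(F + tH)` at `t = 0`. -/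
def variation (F H : Fin 3 → Poly) (A : Poly) : Poly :=
  ∑ k, bind₁ F (pderiv k A) * H k

theorem hasFDerivAt_eval (A : Poly) (u : Fin 3 → ℂ) :
    HasFDerivAt (fun w : Fin 3 → ℂ => eval w A)
      (∑ k, eval u (pderiv k A) • ContinuousLinearMap.proj (R := ℂ) (φ := fun _ : Fin 3 => ℂ) k)
      u := by
  induction A using MvPolynomial.induction_on with
  | C a =>
    simp only [eval_C]
    refine (hasFDerivAt_const (𝕜 := ℂ) a u).congr_fderiv ?_
    ext w
    simp
  | add p q hp hq =>
    simp only [map_add]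
    refine (hp.fun_add hq).congr_fderiv ?_
    ext w
    simp [add_mul, Finset.sum_add_distrib]
  | mul_X p i hp =>
    have hX : HasFDerivAt (fun w : Fin 3 → ℂ => w i)
      (ContinuousLinearMap.proj (R := ℂ) (φ := fun _ : Fin 3 => ℂ) i) u := hasFDerivAt_apply i u
    simp only [map_mul, eval_X]
    refine (hp.mul hX).congr_fderiv ?_
    ext w
    simp only [Derivation.leibniz, pderiv_X, smul_eq_mul, map_add, map_mul, eval_X]
    simp [add_mul, Finset.sum_add_distrib, Pi.single_apply, Finset.mul_sum, mul_assoc, apply_ite]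

/-- The exponents of the monomials of degree `d`. -/
abbrev Exponents (d : ℕ) : Type := (Finset.univ.finsuppAntidiag d : Finset (Fin 3 →₀ ℕ))

/-- The homogeneous polynomial with given coefficients. -/
def form (d : ℕ) : (Exponents d → ℂ) →ₗ[ℂ] Poly :=
  ∑ m : Exponents d, monomial (m : Fin 3 →₀ ℕ) ∘ₗ LinearMap.proj m

theorem mem_finsuppAntidiag_iff_degree {d : ℕ} {m : Fin 3 →₀ ℕ} :
    m ∈ (Finset.univ.finsuppAntidiag d : Finset (Fin 3 →₀ ℕ)) ↔ m.degree = d := by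
  simp [Finset.mem_finsuppAntidiag, Finsupp.degree_eq_sum]

theorem form_apply (d : ℕ) (c : Exponents d → ℂ) :
    form d c = ∑ m : Exponents d, monomial (m : Fin 3 →₀ ℕ) (c m) := by
  simp [form]

theorem coeff_form {d : ℕ} (c : Exponents d → ℂ) (m : Exponents d) :
    coeff (m : Fin 3 →₀ ℕ) (form d c) = c m := by
  classical
  simp [form_apply, coeff_sum, coeff_monomial]

theorem form_injective (d : ℕ) : Function.Injective (form d) := fun c c' h => by
  funext m
  rw [← coeff_form c m, h, coeff_form]

theorem isHomogeneous_form {d : ℕ} (c : Exponents d → ℂ) : (form d c).IsHomogeneous d := by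
  rw [form_apply]
  refine IsHomogeneous.sum _ _ _ fun m _ => isHomogeneous_monomial _ ?_
  exact mem_finsuppAntidiag_iff_degree.mp m.2

theorem form_coeff {d : ℕ} {P : Poly} (hP : P.IsHomogeneous d) :
    form d (fun m => coeff (m : Fin 3 →₀ ℕ) P) = P := by
  ext m
  by_cases hm : m.degree = d
  · exact coeff_form _ ⟨m, mem_finsuppAntidiag_iff_degree.mpr hm⟩
  · rw [(isHomogeneous_form _).coeff_eq_zero hm, hP.coeff_eq_zero hm]

/-- Evaluation of the homogeneous polynomial with given coefficients. -/
def evalForm (d : ℕ) (x : Fin 3 → ℂ) : (Exponents d → ℂ) →L[ℂ] ℂ :=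
  LinearMap.toContinuousLinearMap ((aeval x).toLinearMap ∘ₗ form d)

theorem evalForm_apply (d : ℕ) (x : Fin 3 → ℂ) (c : Exponents d → ℂ) :
    evalForm d x c = eval x (form d c) := by
  rw [← coe_aeval_eq_eval]; rfl

theorem eval_bind (x : Fin 3 → ℂ) (F : Fin 3 → Poly) (A : Poly) :
    eval x (bind₁ F A) = eval (fun k => eval x (F k)) A := by
  rw [← coe_aeval_eq_eval, ← coe_aeval_eq_eval]
  exact aeval_bind₁ _ _ _

/-- An uncountable set of homogeneous triples has at some point a nonzero tangent vector. Only
the equations expressing that the triples commute with a given one are recorded. -/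
theorem exists_tangent_triple {d : ℕ} {S : Set (Fin 3 → Poly)} (hS : ¬ S.Countable)
    (hhom : ∀ F ∈ S, ∀ i, (F i).IsHomogeneous d) {m₀ : Fin 3 →₀ ℕ}
    (hm₀ : ∀ F ∈ S, coeff m₀ (F 0) = 1) :
    ∃ F ∈ S, ∃ H : Fin 3 → Poly, (∀ i, (H i).IsHomogeneous d) ∧ H ≠ 0 ∧ coeff m₀ (H 0) = 0 ∧
      ∀ Γ : Fin 3 → Poly, (∀ F' ∈ S, ∀ i j,
        bind₁ Γ (F' i) * bind₁ F' (Γ j) = bind₁ Γ (F' j) * bind₁ F' (Γ i)) →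
      ∀ i j, bind₁ Γ (H i) * bind₁ F (Γ j) + bind₁ Γ (F i) * variation F H (Γ j)
        = bind₁ Γ (H j) * bind₁ F (Γ i) + bind₁ Γ (F j) * variation F H (Γ i) := by
  let coords : (Fin 3 → Poly) → (Fin 3 → Exponents d → ℂ) :=
    fun F i m => coeff (m : Fin 3 →₀ ℕ) (F i)
  have hform : ∀ F ∈ S, ∀ i, form d (coords F i) = F i := fun F hF i => form_coeff (hhom F hF i)
  have hinj : Set.InjOn coords S := by
    intro F hF F' hF' h
    funext i
    rw [← hform F hF, h, hform F' hF']
  have hT : ¬ (coords '' S).Countable := fun h =>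
    hS (Set.countable_of_injective_of_countable_image hinj h)
  obtain ⟨_, ⟨F, hF, rfl⟩, v, hv, key⟩ := exists_tangent_of_not_countable hT
  have hdeg : m₀.degree = d := by
    by_contra h
    have h1 := hm₀ F hF
    rw [(hhom F hF 0).coeff_eq_zero h] at h1
    exact zero_ne_one h1
  refine ⟨F, hF, fun i => form d (v i), fun i => isHomogeneous_form _, ?_, ?_, ?_⟩
  · intro h
    apply hv
    funext i
    exact form_injective d (by rw [congrFun h i]; simp)
  · let n₀ : Exponents d := ⟨m₀, mem_finsuppAntidiag_iff_degree.mpr hdeg⟩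
    let ℓ : (Fin 3 → Exponents d → ℂ) →L[ℂ] ℂ := (ContinuousLinearMap.proj n₀).comp
      (ContinuousLinearMap.proj (R := ℂ) (φ := fun _ : Fin 3 => Exponents d → ℂ) 0)
    have h1 := key ℓ ℓ 1 ℓ.hasFDerivAt (by
        rintro _ ⟨F', hF', rfl⟩
        exact hm₀ F' hF')
    exact (coeff_form (v 0) n₀).trans h1
  · intro Γ hΓ i j
    -- Since ℂ is infinite, the identity may be tested at each `x`. There it is the derivative of a
    -- scalar function of the coefficients: `F'ᵢ(Γ(x))` is linear in them, and `Γⱼ(F'(x))` is a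
    -- polynomial composed with a linear map.
    refine MvPolynomial.funext fun x => ?_
    let y : Fin 3 → ℂ := fun k => eval x (Γ k)
    let pr (k : Fin 3) :=
      ContinuousLinearMap.proj (R := ℂ) (φ := fun _ : Fin 3 => Exponents d → ℂ) k
    let L (k : Fin 3) : (Fin 3 → Exponents d → ℂ) →L[ℂ] ℂ := (evalForm d y).comp (pr k)
    let M : (Fin 3 → Exponents d → ℂ) →L[ℂ] (Fin 3 → ℂ) :=
      ContinuousLinearMap.pi fun k => (evalForm d x).comp (pr k)
    have hL : ∀ k c, L k c = eval x (bind₁ Γ (form d (c k))) := fun k c => by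
      rw [eval_bind]
      exact evalForm_apply _ _ _
    have hM : ∀ c A, eval (M c) A = eval x (bind₁ (fun k => form d (c k)) A) := fun c A => by
      rw [eval_bind]
      congr 2
    have hM' : ∀ c k, M c k = eval x (form d (c k)) := fun c k => evalForm_apply _ _ _
    have hN : ∀ A, HasFDerivAt (fun c => eval (M c) A) _ (coords F) := fun A =>
      (hasFDerivAt_eval A (M (coords F))).comp (coords F) M.hasFDerivAt
    have h1 := key _ _ 0 ((((L i).hasFDerivAt).mul (hN (Γ j))).sub
        (((L j).hasFDerivAt).mul (hN (Γ i)))) (by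
      rintro _ ⟨F', hF', rfl⟩
      have hF'' : (fun k => form d (coords F' k)) = F' := funext (hform F' hF')
      change L i _ * eval _ _ - L j _ * eval _ _ = 0
      rw [hL, hL, hM, hM, hF'', hform F' hF', hform F' hF', ← map_mul, ← map_mul, hΓ F' hF' i j,
        sub_self])
    simp only [sub_apply, add_apply,
      smul_apply, ContinuousLinearMap.comp_apply,
      sum_apply, ContinuousLinearMap.proj_apply, smul_eq_mul, hL, hM, hM',
      hform F hF] at h1
    simp only [map_add, map_mul, variation, map_sum]
    linear_combination h1

/-! ### The vector field attached to a tangent vector -/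

theorem aeval_mul_left {R : Type*} [CommRing R] [Algebra ℂ R] {A : Poly} {n : ℕ}
    (hA : A.IsHomogeneous n) (c : R) (a : Fin 3 → R) :
    aeval (fun i => c * a i) A = c ^ n * aeval a A := by
  rw [A.as_sum]
  simp only [map_sum, Finset.mul_sum]
  refine Finset.sum_congr rfl fun m hm => ?_
  have hd := hA (mem_support_iff.mp hm)
  rw [aeval_monomial, aeval_monomial]
  simp only [Finsupp.prod, mul_pow, Finset.prod_mul_distrib]
  rw [Finset.prod_pow_eq_pow_sum]
  have : ∑ i ∈ m.support, m i = n := by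
    rw [← hd]
    simp [Finsupp.weight_apply, Finsupp.sum]
  rw [this]
  ring

/-- Both sides are `A` evaluated at one point, `b₀ a = a₀ b`. No division occurs, so this applies
over the dual numbers. -/
theorem pow_mul_aeval {R : Type*} [CommRing R] [Algebra ℂ R] {A : Poly} {n : ℕ}
    (hA : A.IsHomogeneous n) {a b : Fin 3 → R} (h : ∀ i j, b i * a j = b j * a i) :
    b 0 ^ n * aeval a A = a 0 ^ n * aeval b A := by
  rw [← aeval_mul_left hA, ← aeval_mul_left hA]
  congr 2
  funext i
  rw [h 0 i, mul_comm]

theorem isHomogeneous_variation {F H : Fin 3 → Poly} {d n : ℕ}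
    (hF : ∀ i, (F i).IsHomogeneous d) (hH : ∀ i, (H i).IsHomogeneous d) {A : Poly}
    (hA : A.IsHomogeneous n) : (variation F H A).IsHomogeneous (d * n) := by
  refine IsHomogeneous.sum _ _ _ fun k _ => ?_
  rcases n with _ | n
  · have : pderiv k A = 0 := by
      rw [(totalDegree_eq_zero_iff_eq_C (p := A)).mp (by
        by_cases h : A = 0
        · simp [h]
        · exact hA.totalDegree h), pderiv_C]
    rw [this, map_zero, zero_mul]
    exact isHomogeneous_zero _ _ _
  · have h1 : (pderiv k A).IsHomogeneous n := hA.pderiv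
    exact (isHomogeneous_bind h1 hF).mul (hH k)

/-- The point `F + εH` over the dual numbers. -/
def dualPoint (F H : Fin 3 → Poly) (k : Fin 3) : DualNumber RatFun :=
  TrivSqZeroExt.inl (algebraMap Poly RatFun (F k)) +
    TrivSqZeroExt.inr (algebraMap Poly RatFun (H k))

theorem fst_aeval_dualPoint (F H : Fin 3 → Poly) (A : Poly) :
    (aeval (dualPoint F H) A).fst = algebraMap Poly RatFun (bind₁ F A) := by
  induction A using MvPolynomial.induction_on with
  | C a =>
    rw [aeval_C, bind₁_C_right, TrivSqZeroExt.algebraMap_eq_inl', TrivSqZeroExt.fst_inl,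
      IsScalarTower.algebraMap_apply ℂ Poly RatFun, MvPolynomial.algebraMap_eq]
  | add p q hp hq => simp [hp, hq]
  | mul_X p i hp => simp [hp, dualPoint]

theorem variation_mul_X (F H : Fin 3 → Poly) (A : Poly) (i : Fin 3) :
    variation F H (A * X i) = bind₁ F A * H i + variation F H A * F i := by
  simp only [variation, Derivation.leibniz, pderiv_X, smul_eq_mul, map_add, map_mul,
    bind₁_X_right, add_mul, Finset.sum_add_distrib, Finset.sum_mul]
  refine congrArg₂ (· + ·) ?_ (Finset.sum_congr rfl fun k _ => by ring)
  simp [Pi.single_apply, apply_ite]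

theorem snd_aeval_dualPoint (F H : Fin 3 → Poly) (A : Poly) :
    (aeval (dualPoint F H) A).snd = algebraMap Poly RatFun (variation F H A) := by
  induction A using MvPolynomial.induction_on with
  | C a => simp [variation, TrivSqZeroExt.algebraMap_eq_inl']
  | add p q hp hq => simp [hp, hq, variation, add_mul, Finset.sum_add_distrib]
  | mul_X p i hp =>
    have hprod : (aeval (dualPoint F H) (p * X i)).snd
        = (aeval (dualPoint F H) p).fst * algebraMap Poly RatFun (H i)
          + (aeval (dualPoint F H) p).snd * algebraMap Poly RatFun (F i) := by
      simp only [map_mul, aeval_X, DualNumber.snd_mul, dualPoint, TrivSqZeroExt.snd_add,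
        TrivSqZeroExt.fst_add, TrivSqZeroExt.fst_inl, TrivSqZeroExt.snd_inl,
        TrivSqZeroExt.fst_inr, TrivSqZeroExt.snd_inr, add_zero, zero_add]
    rw [hprod, hp, fst_aeval_dualPoint]
    rw [variation_mul_X, map_add, map_mul, map_mul]

/-! ### Differentiation along a first-order deformation of a birational map -/

namespace BirationalTriple

/-- A dual number is a unit as soon as its value at `ε = 0` is; here that value is `A ∘ F`, nonzero
by injectivity of substitution. This lets `F + εH` be substituted into denominators. -/
theorem isUnit_aeval_dualPoint (F : BirationalTriple) (H : Fin 3 → Poly) {A : Poly}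
    (hA : A ≠ 0) : IsUnit (aeval (dualPoint F.coord H) A) := by
  rw [TrivSqZeroExt.isUnit_iff_isUnit_fst, fst_aeval_dualPoint, isUnit_iff_ne_zero]
  intro h
  apply hA
  apply F.injective
  rw [map_zero]
  exact (IsFractionRing.injective Poly RatFun) (by rw [h, map_zero])

/-- The substitution of `F + εH` into rational functions. -/
def jet (F : BirationalTriple) (H : Fin 3 → Poly) : RatFun →ₐ[ℂ] DualNumber RatFun :=
  IsLocalization.liftAlgHom (M := nonZeroDivisors Poly) (f := aeval (dualPoint F.coord H))
    fun A => F.isUnit_aeval_dualPoint H (nonZeroDivisors.ne_zero A.2)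

theorem jet_algebraMap (F : BirationalTriple) (H : Fin 3 → Poly) (A : Poly) :
    F.jet H (algebraMap Poly RatFun A) = aeval (dualPoint F.coord H) A := by
  rw [jet, IsLocalization.liftAlgHom_apply]
  exact IsLocalization.lift_eq _ _

theorem jet_div_mul (F : BirationalTriple) (H : Fin 3 → Poly) (A : Poly) {B : Poly} (hB : B ≠ 0) :
    F.jet H (algebraMap Poly RatFun A / algebraMap Poly RatFun B)
      * aeval (dualPoint F.coord H) B = aeval (dualPoint F.coord H) A := by
  rw [← jet_algebraMap, ← jet_algebraMap, ← map_mul, div_mul_cancel₀ _ (by simpa using hB)]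

theorem subst_ne_zero (F : BirationalTriple) {A : Poly} (hA : A ≠ 0) :
    algebraMap Poly RatFun (bind₁ F.coord A) ≠ 0 := by
  intro h
  exact hA (F.injective_algHom (h.trans (by rw [map_zero])))

theorem fst_jet (F : BirationalTriple) (H : Fin 3 → Poly) (a : RatFun) :
    (F.jet H a).fst = F.subst a := by
  obtain ⟨A, B, hB, rfl⟩ := IsFractionRing.div_surjective (A := Poly) a
  have hB0 := nonZeroDivisors.ne_zero hB
  have h1 := congrArg TrivSqZeroExt.fst (F.jet_div_mul H A hB0)
  rw [TrivSqZeroExt.fst_mul, fst_aeval_dualPoint, fst_aeval_dualPoint] at h1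
  rw [map_div₀ F.subst, subst_algebraMap, subst_algebraMap, eq_div_iff (F.subst_ne_zero hB0), h1]

theorem snd_jet_div (F : BirationalTriple) (H : Fin 3 → Poly) (A : Poly) {B : Poly}
    (hB : B ≠ 0) :
    (F.jet H (algebraMap Poly RatFun A / algebraMap Poly RatFun B)).snd =
      algebraMap Poly RatFun (variation F.coord H A * bind₁ F.coord B
        - bind₁ F.coord A * variation F.coord H B) /
      algebraMap Poly RatFun (bind₁ F.coord B * bind₁ F.coord B) := by
  have h0 := F.subst_ne_zero hB
  have h1 := congrArg TrivSqZeroExt.snd (F.jet_div_mul H A hB)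
  rw [DualNumber.snd_mul, fst_aeval_dualPoint, snd_aeval_dualPoint, snd_aeval_dualPoint, fst_jet,
    map_div₀, subst_algebraMap, subst_algebraMap] at h1
  rw [eq_div_iff (by rw [map_mul]; exact mul_ne_zero h0 h0)]
  simp only [map_sub, map_mul]
  rw [← h1]
  field_simp
  ring

/-- In the quotient rule the numerator and denominator are homogeneous of the same degree, because
`H` has the degree of `F`. -/
theorem snd_jet_mem (F : BirationalTriple) {H : Fin 3 → Poly}
    (hH : ∀ i, (H i).IsHomogeneous F.degree) {a : RatFun} (ha : a ∈ functionField) :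
    (F.jet H a).snd ∈ functionField := by
  obtain ⟨n, A, B, hA, hB, h0, rfl⟩ := ha
  rw [snd_jet_div _ _ _ h0]
  have hB' := isHomogeneous_bind hB F.homogeneous
  refine ⟨_, _, _, ((isHomogeneous_variation F.homogeneous hH hA).mul hB').sub
    ((isHomogeneous_bind hA F.homogeneous).mul (isHomogeneous_variation F.homogeneous hH hB)),
    hB'.mul hB', ?_, rfl⟩
  have : bind₁ F.coord B ≠ 0 := fun h => h0 (F.injective (by rw [h, map_zero]))
  exact mul_ne_zero this this

/-- The derivative of `φ ∘ (F + tH)` at `t = 0`, for a rational function `φ` on the plane. -/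
def derivAlong (F : BirationalTriple) {H : Fin 3 → Poly}
    (hH : ∀ i, (H i).IsHomogeneous F.degree) : functionField →ₗ[ℂ] functionField where
  toFun a := ⟨(F.jet H a).snd, F.snd_jet_mem hH a.2⟩
  map_add' a b := by ext; simp
  map_smul' c a := by ext; simp

/-- This is a derivation relative to `F^*`; composing with the inverse of `F^*` makes it a vector
field. -/
theorem derivAlong_mul (F : BirationalTriple) {H : Fin 3 → Poly}
    (hH : ∀ i, (H i).IsHomogeneous F.degree) (a b : functionField) :
    F.derivAlong hH (a * b) = F.pullback a * F.derivAlong hH b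
      + F.pullback b * F.derivAlong hH a := by
  ext
  change (F.jet H (a * b : RatFun)).snd = F.subst a * (F.jet H b).snd + F.subst b * (F.jet H a).snd
  rw [map_mul, DualNumber.snd_mul, fst_jet, fst_jet]
  ring

/-- The vector field `(dF_t/dt) ∘ F⁻¹` for `F_t = F + tH` at `t = 0`. -/
def tangentField (F : BirationalTriple) {H : Fin 3 → Poly}
    (hH : ∀ i, (H i).IsHomogeneous F.degree) : RationalVectorField :=
  Derivation.mk' ((Cremona.mk F).pullback.symm.toLinearMap ∘ₗ F.derivAlong hH)
    (fun a b => by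
      have h : ∀ c, F.pullback c = (Cremona.mk F).pullback c := fun _ => rfl
      simp [derivAlong_mul, h])

theorem tangentField_apply (F : BirationalTriple) {H : Fin 3 → Poly}
    (hH : ∀ i, (H i).IsHomogeneous F.degree) (a : functionField) :
    F.tangentField hH a = (Cremona.mk F).pullback.symm (F.derivAlong hH a) := rfl

/-- The derivative of `xᵢ / xⱼ` along `F + tH` is `(Hᵢ Fⱼ - Fᵢ Hⱼ) / Fⱼ²`. -/
theorem tangentField_ne_zero (F : BirationalTriple) {H : Fin 3 → Poly}
    (hH : ∀ i, (H i).IsHomogeneous F.degree) {i j : Fin 3}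
    (hij : H i * F.coord j ≠ H j * F.coord i) : F.tangentField hH ≠ 0 := by
  intro h
  have h1 : F.tangentField hH (ratio i j) = 0 := by rw [h]; rfl
  rw [tangentField_apply, EmbeddingLike.map_eq_zero_iff] at h1
  have h2 : (F.jet H (algebraMap Poly RatFun (X i) / algebraMap Poly RatFun (X j))).snd = 0 :=
    congrArg Subtype.val h1
  have hX : ∀ k, variation F.coord H (X k) = H k := fun k => by
    simp [variation, pderiv_X, Pi.single_apply, apply_ite]
  rw [snd_jet_div _ _ _ (X_ne_zero j), hX, hX, bind₁_X_right, bind₁_X_right,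
    div_eq_zero_iff] at h2
  rcases h2 with h2 | h2
  · have h3 := IsFractionRing.injective Poly RatFun (h2.trans (map_zero _).symm)
    exact hij (by linear_combination h3)
  · have h3 := IsFractionRing.injective Poly RatFun (h2.trans (map_zero _).symm)
    exact mul_ne_zero (F.coord_ne j) (F.coord_ne j) h3

/-- The extension of an endomorphism of the field of rational functions to dual numbers. -/
def dualMap (σ : RatFun →ₐ[ℂ] RatFun) : DualNumber RatFun →ₐ[ℂ] DualNumber RatFun :=
  DualNumber.lift ⟨((TrivSqZeroExt.inlAlgHom ℂ RatFun RatFun).comp σ, DualNumber.eps),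
    DualNumber.eps_mul_eps, fun _ => DualNumber.commute_eps_left _⟩

theorem fst_dualMap (σ : RatFun →ₐ[ℂ] RatFun) (x : DualNumber RatFun) :
    (dualMap σ x).fst = σ x.fst := by
  simp [dualMap, DualNumber.lift_apply_apply]

theorem snd_dualMap (σ : RatFun →ₐ[ℂ] RatFun) (x : DualNumber RatFun) :
    (dualMap σ x).snd = σ x.snd := by
  simp [dualMap, DualNumber.lift_apply_apply]

/-- The equations of a tangent vector to the maps commuting with `Γ`. -/
def IsTangentToCommutant (F : BirationalTriple) (H : Fin 3 → Poly) (Γ : BirationalTriple) : Prop :=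
  ∀ i j, bind₁ Γ.coord (H i) * bind₁ F.coord (Γ.coord j)
      + bind₁ Γ.coord (F.coord i) * variation F.coord H (Γ.coord j)
    = bind₁ Γ.coord (H j) * bind₁ F.coord (Γ.coord i)
      + bind₁ Γ.coord (F.coord j) * variation F.coord H (Γ.coord i)

/-- To first order, `Γ ∘ (F + εH)` and `(F + εH) ∘ Γ` are the same projective point over the dual
numbers: `hcomm` is the constant part of the proportionality and `hT` its `ε`-part. A quotient of
forms of equal degree takes the same value on both. -/
theorem derivAlong_pullback (F : BirationalTriple) {H : Fin 3 → Poly}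
    (hH : ∀ i, (H i).IsHomogeneous F.degree) {Γ : BirationalTriple} (hcomm : F.comp Γ ≈ Γ.comp F)
    (hT : F.IsTangentToCommutant H Γ) (a : functionField) :
    F.derivAlong hH (Γ.pullback a) = Γ.pullback (F.derivAlong hH a) := by
  obtain ⟨_, n, A, B, hA, hB, h0, rfl⟩ := a
  set x : RatFun := algebraMap Poly RatFun A / algebraMap Poly RatFun B with hx
  suffices h : F.jet H (Γ.subst x) = dualMap Γ.subst (F.jet H x) by
    ext
    change (F.jet H (Γ.subst x)).snd = Γ.subst (F.jet H x).snd
    rw [h, snd_dualMap]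
  -- Here `a` is `Γ ∘ (F + εH)` and `b` is `(F + εH) ∘ Γ`.
  let a : Fin 3 → DualNumber RatFun := fun i => aeval (dualPoint F.coord H) (Γ.coord i)
  let b : Fin 3 → DualNumber RatFun := fun i => dualMap Γ.subst (dualPoint F.coord H i)
  have hab : ∀ i j, b i * a j = b j * a i := by
    intro i j
    have hf : ∀ i, (b i).fst = algebraMap Poly RatFun (bind₁ Γ.coord (F.coord i)) := fun i => by
      simp only [b, fst_dualMap, dualPoint, TrivSqZeroExt.fst_add, TrivSqZeroExt.fst_inl,
        TrivSqZeroExt.fst_inr, add_zero, subst_algebraMap]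
    have hs : ∀ i, (b i).snd = algebraMap Poly RatFun (bind₁ Γ.coord (H i)) := fun i => by
      simp only [b, snd_dualMap, dualPoint, TrivSqZeroExt.snd_add, TrivSqZeroExt.snd_inl,
        TrivSqZeroExt.snd_inr, zero_add, subst_algebraMap]
    refine TrivSqZeroExt.ext ?_ ?_
    · rw [TrivSqZeroExt.fst_mul, TrivSqZeroExt.fst_mul, hf, hf, fst_aeval_dualPoint,
        fst_aeval_dualPoint, ← map_mul, ← map_mul]
      exact congrArg _ (hcomm i j)
    · rw [DualNumber.snd_mul, DualNumber.snd_mul, hf, hf, hs, hs, fst_aeval_dualPoint,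
        fst_aeval_dualPoint, snd_aeval_dualPoint, snd_aeval_dualPoint]
      have h := congrArg (algebraMap Poly RatFun) (hT i j)
      simp only [map_add, map_mul] at h
      linear_combination h
  have ha : ∀ P : Poly, aeval a P = aeval (dualPoint F.coord H) (bind₁ Γ.coord P) := fun P =>
    (aeval_bind₁ _ _ _).symm
  have hb : ∀ P : Poly, aeval b P = dualMap Γ.subst (aeval (dualPoint F.coord H) P) := fun P => by
    rw [← AlgHom.comp_apply, comp_aeval]
  have hb0 : IsUnit (b 0) := by
    have := (F.isUnit_aeval_dualPoint H (X_ne_zero 0)).map (dualMap Γ.subst)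
    rwa [aeval_X] at this
  have hΓB : bind₁ Γ.coord B ≠ 0 := fun h => h0 (Γ.injective (by rw [h, map_zero]))
  have haB : IsUnit (aeval a B) := by
    rw [ha]
    exact F.isUnit_aeval_dualPoint H hΓB
  have h1 : F.jet H (Γ.subst x) * aeval a B = aeval a A := by
    rw [hx, map_div₀, subst_algebraMap, subst_algebraMap, ha, ha, F.jet_div_mul H _ hΓB]
  have h2 : dualMap Γ.subst (F.jet H x) * aeval b B = aeval b A := by
    rw [hb, hb, ← map_mul, hx, F.jet_div_mul H _ h0]
  have h3 := pow_mul_aeval hA hab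
  have h4 := pow_mul_aeval hB hab
  apply haB.mul_right_cancel
  apply (hb0.pow n).mul_left_cancel
  linear_combination b 0 ^ n * h1 + h3 - a 0 ^ n * h2 - dualMap Γ.subst (F.jet H x) * h4

theorem pushforward_tangentField (F : BirationalTriple) {H : Fin 3 → Poly}
    (hH : ∀ i, (H i).IsHomogeneous F.degree) {Γ : BirationalTriple}
    (hcomm : Cremona.mk F * Cremona.mk Γ = Cremona.mk Γ * Cremona.mk F)
    (hT : F.IsTangentToCommutant H Γ) :
    Cremona.pushforward (Cremona.mk Γ) (F.tangentField hH) = F.tangentField hH := by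
  have hpull : ∀ c, (Cremona.mk F).pullback ((Cremona.mk Γ).pullback c)
      = (Cremona.mk Γ).pullback ((Cremona.mk F).pullback c) := fun c => by
    have h1 := DFunLike.congr_fun (Cremona.pullbackHom_mul (Cremona.mk F) (Cremona.mk Γ)) c
    have h2 := DFunLike.congr_fun (Cremona.pullbackHom_mul (Cremona.mk Γ) (Cremona.mk F)) c
    rw [hcomm] at h1
    exact h2.symm.trans h1
  refine Derivation.ext fun c => ?_
  change (Cremona.mk Γ).pullback.symm (F.tangentField hH ((Cremona.mk Γ).pullback c)) = _
  rw [AlgEquiv.symm_apply_eq, tangentField_apply, tangentField_apply, AlgEquiv.symm_apply_eq,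
    hpull, AlgEquiv.apply_symm_apply]
  exact F.derivAlong_pullback hH (Quotient.exact hcomm) hT c

end BirationalTriple

/-! ### The foliation defined by a vector field -/

theorem eq_C_of_isHomogeneous_zero {A : Poly} (hA : A.IsHomogeneous 0) : A = C (coeff 0 A) := by
  refine totalDegree_eq_zero_iff_eq_C.mp ?_
  by_cases h : A = 0
  · simp [h]
  · exact hA.totalDegree h

theorem pderiv_eq_zero_of_isHomogeneous_zero {A : Poly} (hA : A.IsHomogeneous 0) (k : Fin 3) :
    pderiv k A = 0 := by
  rw [eq_C_of_isHomogeneous_zero hA, pderiv_C]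

/-- The dehomogenisation `A(1, x₁ / x₀, x₂ / x₀)`. -/
def affinePart : Poly →ₐ[ℂ] functionField := aeval fun i => ratio i 0

theorem coe_ratio (i j : Fin 3) : (ratio i j : RatFun)
    = algebraMap Poly RatFun (X i) / algebraMap Poly RatFun (X j) := rfl

theorem algebraMap_X_ne_zero (i : Fin 3) : algebraMap Poly RatFun (X i) ≠ 0 := by
  simp [X_ne_zero]

theorem pow_mul_affinePart {A : Poly} {n : ℕ} (hA : A.IsHomogeneous n) :
    algebraMap Poly RatFun (X 0) ^ n * (affinePart A : RatFun) = algebraMap Poly RatFun A := by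
  have h1 : (affinePart A : RatFun) = aeval (fun i => (ratio i 0 : RatFun)) A := by
    change functionField.val (aeval _ A) = _
    rw [← AlgHom.comp_apply, comp_aeval]
    rfl
  rw [h1, ← aeval_mul_left hA]
  have h2 : (fun i => algebraMap Poly RatFun (X 0) * (ratio i 0 : RatFun))
      = fun i => algebraMap Poly RatFun (X i) := by
    funext i
    rw [coe_ratio, mul_div_cancel₀ _ (algebraMap_X_ne_zero 0)]
  rw [h2]
  have h3 : (aeval fun i => algebraMap Poly RatFun (X i)) = Algebra.algHom ℂ Poly RatFun := by
    ext i
    rw [aeval_X]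
    rfl
  rw [h3]
  rfl

theorem coe_affinePart {A : Poly} {n : ℕ} (hA : A.IsHomogeneous n) :
    (affinePart A : RatFun) = algebraMap Poly RatFun A / algebraMap Poly RatFun (X 0) ^ n := by
  rw [eq_div_iff (pow_ne_zero _ (algebraMap_X_ne_zero 0)), mul_comm, pow_mul_affinePart hA]

theorem affinePart_ne_zero {A : Poly} {n : ℕ} (hA : A.IsHomogeneous n) (h0 : A ≠ 0) :
    affinePart A ≠ 0 := by
  intro h
  have h1 := pow_mul_affinePart hA
  rw [h] at h1
  exact h0 (IsFractionRing.injective Poly RatFun (by rw [← h1, map_zero]; simp))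

theorem apply_affinePart (χ : RationalVectorField) (A : Poly) :
    χ (affinePart A) = ∑ k, affinePart (pderiv k A) * χ (ratio k 0) := by
  induction A using MvPolynomial.induction_on with
  | C a =>
    have : affinePart (C a) = algebraMap ℂ functionField a := aeval_C _ _
    rw [this, Derivation.map_algebraMap]
    simp
  | add p q hp hq => simp [hp, hq, add_mul, Finset.sum_add_distrib]
  | mul_X p i hp =>
    have : affinePart (X i) = ratio i 0 := aeval_X _ _
    simp only [map_mul, Derivation.leibniz, pderiv_X, smul_eq_mul, map_add, this, hp, add_mul,
      Finset.sum_add_distrib, Finset.mul_sum]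
    refine congrArg₂ (· + ·) ?_ (Finset.sum_congr rfl fun k _ => by ring)
    simp [Pi.single_apply, apply_ite]

/-- Chain rule, rehomogenised. The partial derivatives have degree `n - 1`, whence the factor `x₀`
on the right; in degree 0 both sides vanish. -/
theorem pow_mul_apply_affinePart (χ : RationalVectorField) {A : Poly} {n : ℕ}
    (hA : A.IsHomogeneous n) :
    algebraMap Poly RatFun (X 0) ^ n * (χ (affinePart A) : RatFun)
      = algebraMap Poly RatFun (X 0) *
        ∑ k, algebraMap Poly RatFun (pderiv k A) * (χ (ratio k 0) : RatFun) := by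
  have hcoe : (χ (affinePart A) : RatFun)
      = ∑ k, (affinePart (pderiv k A) : RatFun) * (χ (ratio k 0) : RatFun) := by
    rw [apply_affinePart]
    push_cast
    rfl
  rw [hcoe, Finset.mul_sum, Finset.mul_sum]
  refine Finset.sum_congr rfl fun k _ => ?_
  rcases n with _ | n
  · simp [pderiv_eq_zero_of_isHomogeneous_zero hA k]
  · have h1 : (pderiv k A).IsHomogeneous n := hA.pderiv
    rw [← pow_mul_affinePart h1]
    ring

/-- The `xᵢ / x₀` generate the function field, and a derivation that kills generators is zero. -/
theorem exists_apply_ratio_ne_zero {χ : RationalVectorField} (hχ : χ ≠ 0) :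
    ∃ i, χ (ratio i 0) ≠ 0 := by
  by_contra! h
  apply hχ
  refine Derivation.ext fun a => ?_
  have hz : ∀ A, χ (affinePart A) = 0 := fun A => by simp [apply_affinePart, h]
  obtain ⟨a, n, A, B, hA, hB, h0, ha⟩ := a
  have h1 : affinePart B * ⟨a, n, A, B, hA, hB, h0, ha⟩ = affinePart A := by
    ext
    change (affinePart B : RatFun) * a = (affinePart A : RatFun)
    have hB0 : algebraMap Poly RatFun B ≠ 0 := by simpa using h0
    rw [ha, coe_affinePart hA, coe_affinePart hB]
    field_simp
  have h2 := congrArg χ h1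
  rw [Derivation.leibniz, hz, hz, smul_zero, add_zero, smul_eq_mul] at h2
  exact (mul_eq_zero.mp h2).resolve_left (affinePart_ne_zero hB h0)

theorem exists_common_denominator (v : Fin 3 → functionField) :
    ∃ (n : ℕ) (A : Fin 3 → Poly) (B : Poly), (∀ i, (A i).IsHomogeneous n) ∧ B ≠ 0 ∧
      ∀ i, algebraMap Poly RatFun B * (v i : RatFun) = algebraMap Poly RatFun (A i) := by
  choose n A B hA hB h0 hv using fun i => (v i).2
  have hne : ∀ i, algebraMap Poly RatFun (B i) ≠ 0 := fun i => by simpa using h0 i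
  refine ⟨n 0 + n 1 + n 2, ![A 0 * B 1 * B 2, B 0 * A 1 * B 2, B 0 * B 1 * A 2],
    B 0 * B 1 * B 2, ?_, mul_ne_zero (mul_ne_zero (h0 0) (h0 1)) (h0 2), ?_⟩
  · intro i
    fin_cases i
    · exact ((hA 0).mul (hB 1)).mul (hB 2)
    · exact ((hB 0).mul (hA 1)).mul (hB 2)
    · exact ((hB 0).mul (hB 1)).mul (hA 2)
  · have h : ∀ i, algebraMap Poly RatFun (B i) * (v i : RatFun) = algebraMap Poly RatFun (A i) :=
      fun i => by rw [hv i, mul_div_cancel₀ _ (hne i)]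
    intro i
    fin_cases i
    · simp only [Fin.zero_eta, Matrix.cons_val, map_mul]
      linear_combination algebraMap Poly RatFun (B 1) * algebraMap Poly RatFun (B 2) * h 0
    · simp only [Fin.mk_one, Matrix.cons_val, map_mul]
      linear_combination algebraMap Poly RatFun (B 0) * algebraMap Poly RatFun (B 2) * h 1
    · simp only [Fin.reduceFinMk, Matrix.cons_val, map_mul]
      linear_combination algebraMap Poly RatFun (B 0) * algebraMap Poly RatFun (B 1) * h 2

theorem ratio_zero_zero : ratio 0 0 = 1 := by
  ext
  exact div_self (algebraMap_X_ne_zero 0)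

/-- Every nonzero vector field defines a foliation, which is a multiple of the cross product of
the vector field with the radial one. -/
theorem exists_foliation {χ : RationalVectorField} (hχ : χ ≠ 0) :
    ∃ (ω : Foliation) (A : Fin 3 → Poly) (B p : Poly), B ≠ 0 ∧ p ≠ 0 ∧
      (∀ i, algebraMap Poly RatFun B * (χ (ratio i 0) : RatFun) = algebraMap Poly RatFun (A i)) ∧
      ∀ i, X (i + 1) * A (i + 2) - X (i + 2) * A (i + 1) = p * ω.coeff i := by
  obtain ⟨n, A, B, hA, hB, hv⟩ := exists_common_denominator fun i => χ (ratio i 0)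
  have hB' : algebraMap Poly RatFun B ≠ 0 := by simpa using hB
  have hA0 : A 0 = 0 := by
    apply IsFractionRing.injective Poly RatFun
    rw [← hv, ratio_zero_zero, Derivation.map_one_eq_zero]
    simp
  have hne : ∃ i, A i ≠ 0 := by
    obtain ⟨i, hi⟩ := exists_apply_ratio_ne_zero hχ
    refine ⟨i, fun h => hi ?_⟩
    have := hv i
    rw [h, map_zero] at this
    exact Subtype.ext ((mul_eq_zero.mp this).resolve_left hB')
  let W : Fin 3 → Poly := fun i => X (i + 1) * A (i + 2) - X (i + 2) * A (i + 1)
  have hW : ∀ i, (W i).IsHomogeneous (1 + n) := fun i =>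
    ((isHomogeneous_X ℂ _).mul (hA _)).sub ((isHomogeneous_X ℂ _).mul (hA _))
  -- As `A 0 = 0`, the last two components are `-x₀ A₂` and `x₀ A₁`, so `W = 0` would force `A = 0`.
  have hW0 : ∃ i, W i ≠ 0 := by
    by_contra! h
    have h1 := h 1
    have h2 := h 2
    simp only [W, Fin.reduceAdd, hA0, mul_zero, zero_sub, sub_zero, neg_eq_zero, mul_eq_zero,
      X_ne_zero, false_or] at h1 h2
    obtain ⟨i, hi⟩ := hne
    fin_cases i
    · exact hi hA0
    · exact hi h2
    · exact hi h1
  obtain ⟨p, V, k, l, hp, -, -, hV, hWV, hred⟩ := exists_isReduced hW hW0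
  have heuler : ∑ i, X i * V i = 0 := by
    apply mul_left_cancel₀ hp
    rw [mul_zero, Finset.mul_sum]
    have : ∀ i, p * (X i * V i) = X i * W i := fun i => by rw [hWV]; ring
    simp only [this, W, Fin.sum_univ_three, Fin.reduceAdd]
    ring
  -- The coefficients of a foliation have degree at least 1. Constant ones would vanish, as the
  -- Euler relation at the basis vectors shows.
  have hl : l ≠ 0 := by
    rintro rfl
    obtain ⟨i, hi⟩ := hW0
    apply hi
    rw [hWV i]
    have h1 := congrArg (eval (Pi.single i 1 : Fin 3 → ℂ)) heuler
    simp only [map_sum, map_mul, eval_X, map_zero, Pi.single_apply, ite_mul, one_mul, zero_mul,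
      Finset.sum_ite_eq', Finset.mem_univ, if_true] at h1
    rw [eq_C_of_isHomogeneous_zero (hV i), eval_C] at h1
    rw [eq_C_of_isHomogeneous_zero (hV i), h1, map_zero, mul_zero]
  obtain ⟨l, rfl⟩ := Nat.exists_eq_succ_of_ne_zero hl
  exact ⟨⟨V, l, hV, hred, heuler⟩, A, B, p, hB, hp, hv, hWV⟩

/-! ### From an invariant vector field to an invariant foliation -/

section

variable {χ : RationalVectorField} {ω : Foliation} {A : Fin 3 → Poly} {B p : Poly}

theorem sum_coeff_mul_apply_ratio (hB : B ≠ 0) (hp : p ≠ 0)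
    (hA : ∀ i, algebraMap Poly RatFun B * (χ (ratio i 0) : RatFun) = algebraMap Poly RatFun (A i))
    (hω : ∀ i, X (i + 1) * A (i + 2) - X (i + 2) * A (i + 1) = p * ω.coeff i) :
    ∑ i, algebraMap Poly RatFun (ω.coeff i) * (χ (ratio i 0) : RatFun) = 0 := by
  have hB' : algebraMap Poly RatFun B ≠ 0 := by simpa using hB
  have h1 : ∑ i, ω.coeff i * A i = 0 := by
    apply mul_left_cancel₀ hp
    rw [mul_zero, Finset.mul_sum]
    simp only [← mul_assoc, ← hω, Fin.sum_univ_three, Fin.reduceAdd]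
    ring
  apply mul_left_cancel₀ hB'
  rw [mul_zero, ← map_zero (algebraMap Poly RatFun), ← h1, map_sum, Finset.mul_sum]
  refine Finset.sum_congr rfl fun i _ => ?_
  rw [map_mul, ← hA]
  ring

theorem sum_coeff_mul_X (ω : Foliation) :
    ∑ i, algebraMap Poly RatFun (ω.coeff i) * algebraMap Poly RatFun (X i) = 0 := by
  rw [← map_zero (algebraMap Poly RatFun), ← ω.euler, map_sum]
  exact Finset.sum_congr rfl fun i _ => by rw [map_mul, mul_comm]

/-- Changing charts by the Leibniz rule adds to `χ(xᵢ / x₀)` a multiple of `xᵢ`, which `ω` kills by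
the Euler relation. -/
theorem Foliation.isDefinedBy_of_chart
    (h : ∑ i, algebraMap Poly RatFun (ω.coeff i) * (χ (ratio i 0) : RatFun) = 0) :
    ω.IsDefinedBy χ := by
  intro j
  have hj := algebraMap_X_ne_zero j
  have h0 := algebraMap_X_ne_zero 0
  have hr : (ratio j 0 : RatFun) ≠ 0 := div_ne_zero hj h0
  have h1 : ∀ i, (ratio j 0 : RatFun) * (χ (ratio i j) : RatFun)
      = (χ (ratio i 0) : RatFun) - (ratio i j : RatFun) * (χ (ratio j 0) : RatFun) := by
    intro i
    have h2 : ratio j 0 * ratio i j = ratio i 0 := by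
      ext
      change (ratio j 0 : RatFun) * (ratio i j : RatFun) = ratio i 0
      simp only [coe_ratio]
      field_simp
    have h3 := congrArg (fun a => (χ a : RatFun)) h2
    simp only [Derivation.leibniz] at h3
    change (ratio j 0 : RatFun) * (χ (ratio i j) : RatFun)
      + (ratio i j : RatFun) * (χ (ratio j 0) : RatFun) = _ at h3
    linear_combination h3
  apply mul_left_cancel₀ hr
  have h2 : (ratio j 0 : RatFun)
      * ∑ i, algebraMap Poly RatFun (ω.coeff i) * (χ (ratio i j) : RatFun)
      = ∑ i, algebraMap Poly RatFun (ω.coeff i) * (χ (ratio i 0) : RatFun)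
        - ((χ (ratio j 0) : RatFun) / algebraMap Poly RatFun (X j))
        * ∑ i, algebraMap Poly RatFun (ω.coeff i) * algebraMap Poly RatFun (X i) := by
    rw [Finset.mul_sum, Finset.mul_sum, ← Finset.sum_sub_distrib]
    refine Finset.sum_congr rfl fun i _ => ?_
    have h3 := h1 i
    rw [coe_ratio i j] at h3
    linear_combination algebraMap Poly RatFun (ω.coeff i) * h3
  rw [h2, h, sum_coeff_mul_X, mul_zero, mul_zero, sub_zero]

/-- By Euler's formula, `dF` sends the radial field to `deg F` times the radial field along `F`,
which `ω` kills. -/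
theorem sum_X_mul_pullbackCoeff (ω : Foliation) (F : BirationalTriple) :
    ∑ j, X j * ω.pullbackCoeff F j = 0 := by
  have h1 : ∀ i, ∑ j, X j * pderiv j (F.coord i) = F.degree • F.coord i := fun i =>
    (F.homogeneous i).sum_X_mul_pderiv
  have h2 := congrArg (bind₁ F.coord) ω.euler
  simp only [map_sum, map_mul, bind₁_X_right, map_zero] at h2
  simp only [Foliation.pullbackCoeff, Finset.mul_sum]
  rw [Finset.sum_comm]
  have h3 : ∀ i, ∑ j, X j * (bind₁ F.coord (ω.coeff i) * pderiv j (F.coord i))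
      = F.degree • (F.coord i * bind₁ F.coord (ω.coeff i)) := fun i => by
    rw [← smul_mul_assoc, ← h1, Finset.sum_mul]
    exact Finset.sum_congr rfl fun j _ => by ring
  simp only [h3]
  rw [← Finset.smul_sum, h2, smul_zero]

theorem apply_pullback {F : BirationalTriple}
    (hF : Cremona.pushforward (Cremona.mk F) χ = χ) (a : functionField) :
    χ (F.pullback a) = F.pullback (χ a) := by
  have h1 := DFunLike.congr_fun hF a
  change (Cremona.mk F).pullback.symm (χ ((Cremona.mk F).pullback a)) = χ a at h1
  rw [AlgEquiv.symm_apply_eq] at h1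
  exact h1

theorem sum_pullbackCoeff_mul_apply_ratio {F : BirationalTriple}
    (hF : Cremona.pushforward (Cremona.mk F) χ = χ)
    (h : ∑ i, algebraMap Poly RatFun (ω.coeff i) * (χ (ratio i 0) : RatFun) = 0) :
    ∑ j, algebraMap Poly RatFun (ω.pullbackCoeff F j) * (χ (ratio j 0) : RatFun) = 0 := by
  have hX := algebraMap_X_ne_zero 0
  have hF0 := F.subst_ne_zero (X_ne_zero 0)
  rw [bind₁_X_right] at hF0
  have h1 : ∀ i, F.pullback (ratio i 0) * affinePart (F.coord 0) = affinePart (F.coord i) := by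
    intro i
    ext
    change F.subst (ratio i 0) * (affinePart (F.coord 0) : RatFun) = affinePart (F.coord i)
    rw [coe_ratio, map_div₀, F.subst_algebraMap, F.subst_algebraMap, bind₁_X_right,
      bind₁_X_right, coe_affinePart (F.homogeneous 0), coe_affinePart (F.homogeneous i)]
    field_simp
  -- Invariance splits the derivative of `Fᵢ` into the field `χ` at the image point and a radial
  -- term. The form `ω ∘ F` kills each of them (`h3` and `h4`).
  have h2 : ∀ i, (χ (affinePart (F.coord i)) : RatFun)
      = F.subst (χ (ratio i 0)) * (affinePart (F.coord 0) : RatFun)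
        + algebraMap Poly RatFun (F.coord i) * ((χ (affinePart (F.coord 0)) : RatFun)
          / algebraMap Poly RatFun (F.coord 0)) := by
    intro i
    rw [← h1 i, Derivation.leibniz, apply_pullback hF]
    change F.subst (ratio i 0) * (χ (affinePart (F.coord 0)) : RatFun)
      + (affinePart (F.coord 0) : RatFun) * F.subst (χ (ratio i 0)) = _
    rw [coe_ratio, map_div₀, F.subst_algebraMap, F.subst_algebraMap, bind₁_X_right,
      bind₁_X_right]
    ring
  have h3 : ∑ i, algebraMap Poly RatFun (bind₁ F.coord (ω.coeff i))
      * F.subst (χ (ratio i 0)) = 0 := by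
    have := congrArg F.subst h
    simpa only [map_sum, map_mul, F.subst_algebraMap, map_zero] using this
  have h4 : ∑ i, algebraMap Poly RatFun (bind₁ F.coord (ω.coeff i))
      * algebraMap Poly RatFun (F.coord i) = 0 := by
    have := congrArg F.subst (sum_coeff_mul_X ω)
    simpa only [map_sum, map_mul, F.subst_algebraMap, map_zero, bind₁_X_right] using this
  apply mul_left_cancel₀ hX
  calc algebraMap Poly RatFun (X 0)
        * ∑ j, algebraMap Poly RatFun (ω.pullbackCoeff F j) * (χ (ratio j 0) : RatFun)
      = ∑ i, algebraMap Poly RatFun (bind₁ F.coord (ω.coeff i))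
          * (algebraMap Poly RatFun (X 0) * ∑ k, algebraMap Poly RatFun (pderiv k (F.coord i))
            * (χ (ratio k 0) : RatFun)) := by
        simp only [Foliation.pullbackCoeff, map_sum, map_mul, Finset.mul_sum, Finset.sum_mul]
        rw [Finset.sum_comm]
        exact Finset.sum_congr rfl fun i _ => Finset.sum_congr rfl fun k _ => by ring
    _ = ∑ i, algebraMap Poly RatFun (bind₁ F.coord (ω.coeff i))
          * (algebraMap Poly RatFun (X 0) ^ F.degree * (χ (affinePart (F.coord i)) : RatFun)) :=
        Finset.sum_congr rfl fun i _ => by rw [pow_mul_apply_affinePart χ (F.homogeneous i)]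
    _ = algebraMap Poly RatFun (X 0) ^ F.degree * (affinePart (F.coord 0) : RatFun)
          * ∑ i, algebraMap Poly RatFun (bind₁ F.coord (ω.coeff i)) * F.subst (χ (ratio i 0))
        + algebraMap Poly RatFun (X 0) ^ F.degree * ((χ (affinePart (F.coord 0)) : RatFun)
          / algebraMap Poly RatFun (F.coord 0))
          * ∑ i, algebraMap Poly RatFun (bind₁ F.coord (ω.coeff i))
            * algebraMap Poly RatFun (F.coord i) := by
        rw [Finset.mul_sum, Finset.mul_sum, ← Finset.sum_add_distrib]
        exact Finset.sum_congr rfl fun i _ => by rw [h2 i]; ring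
    _ = algebraMap Poly RatFun (X 0) * 0 := by rw [h3, h4, mul_zero, mul_zero, mul_zero, add_zero]

/-- This is `η × (x × a) = (η · a) x - (η · x) a = 0`, after cancelling `p`. -/
theorem mul_eq_mul_of_cross_product {R : Type*} [CommRing R] [IsDomain R] {x a η w : Fin 3 → R}
    {p : R} (hp : p ≠ 0) (hw : ∀ i, x (i + 1) * a (i + 2) - x (i + 2) * a (i + 1) = p * w i)
    (hx : ∑ j, x j * η j = 0) (ha : ∑ j, η j * a j = 0) (i j : Fin 3) :
    η i * w j = η j * w i := by
  have w0 := hw 0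
  have w1 := hw 1
  have w2 := hw 2
  simp only [Fin.sum_univ_three, Fin.reduceAdd, zero_add] at hx ha w0 w1 w2
  have k01 : η 0 * w 1 = η 1 * w 0 := by
    apply mul_left_cancel₀ hp
    linear_combination x 2 * ha - a 2 * hx - η 0 * w1 + η 1 * w0
  have k12 : η 1 * w 2 = η 2 * w 1 := by
    apply mul_left_cancel₀ hp
    linear_combination x 0 * ha - a 0 * hx - η 1 * w2 + η 2 * w1
  have k20 : η 2 * w 0 = η 0 * w 2 := by
    apply mul_left_cancel₀ hp
    linear_combination x 1 * ha - a 1 * hx - η 2 * w0 + η 0 * w2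
  fin_cases i <;> fin_cases j
  exacts [rfl, k01, k20.symm, k01.symm, rfl, k12, k20, k12.symm, rfl]

theorem isInvariant_of_pushforward_eq (hB : B ≠ 0) (hp : p ≠ 0)
    (hA : ∀ i, algebraMap Poly RatFun B * (χ (ratio i 0) : RatFun) = algebraMap Poly RatFun (A i))
    (hω : ∀ i, X (i + 1) * A (i + 2) - X (i + 2) * A (i + 1) = p * ω.coeff i)
    {f : Cremona} (hf : Cremona.pushforward f χ = χ) : ω.IsInvariant f := by
  rintro F rfl
  have h1 := sum_X_mul_pullbackCoeff ω F
  have h2 := sum_pullbackCoeff_mul_apply_ratio hf (sum_coeff_mul_apply_ratio hB hp hA hω)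
  have h3 : ∑ j, ω.pullbackCoeff F j * A j = 0 := by
    apply IsFractionRing.injective Poly RatFun
    rw [map_zero, map_sum, ← mul_zero (algebraMap Poly RatFun B), ← h2, Finset.mul_sum]
    refine Finset.sum_congr rfl fun j _ => ?_
    rw [map_mul, ← hA]
    ring
  exact mul_eq_mul_of_cross_product hp hω h1 h3

end

/-! ### Uncountable abelian groups of birational maps -/

/-- Multiplication of the coordinates by a nonzero constant. -/
def BirationalTriple.scale (F : BirationalTriple) (c : ℂ) (hc : c ≠ 0) : BirationalTriple where
  coord i := C c * F.coord i
  degree := F.degree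
  homogeneous i := (F.homogeneous i).C_mul c
  exists_inverse := by
    have hc' : (C c : Poly) ≠ 0 := by simpa using hc
    obtain ⟨G, e, hG, ⟨q, hq, h1⟩, ⟨q', hq', h2⟩⟩ := F.exists_inverse
    refine ⟨G, e, hG, ⟨C c * q, mul_ne_zero hc' hq, fun i => ?_⟩,
      ⟨C c ^ e * q', mul_ne_zero (pow_ne_zero _ hc') hq', fun i => ?_⟩⟩
    · rw [map_mul, bind₁_C_right, h1]
      ring
    · rw [bind_smul (hG i), h2]
      ring

/-- Fixing a coefficient removes the freedom of scaling, which would otherwise allow a tangent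
vector along `F` itself. -/
theorem Cremona.exists_normalized (f : Cremona) :
    ∃ (F : BirationalTriple) (m : Fin 3 →₀ ℕ), Cremona.mk F = f ∧ IsReduced F.coord ∧
      coeff m (F.coord 0) = 1 := by
  obtain ⟨F₁⟩ := f
  obtain ⟨F, hF, hred⟩ := F₁.exists_isReduced
  obtain ⟨m, hm⟩ := ne_zero_iff.mp (F.coord_ne 0)
  have hc : (coeff m (F.coord 0))⁻¹ ≠ 0 := inv_ne_zero hm
  refine ⟨F.scale _ hc, m, Quotient.sound (Setoid.trans (fun i j => ?_) hF), fun p hp => ?_, ?_⟩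
  · change C _ * F.coord i * F.coord j = C _ * F.coord j * F.coord i
    ring
  · refine hred p fun i => ?_
    have hu : IsUnit (C (coeff m (F.coord 0))⁻¹ : Poly) := (isUnit_iff_ne_zero.mpr hc).map C
    exact (hu.dvd_mul_left).mp (hp i)
  · change coeff m (C _ * F.coord 0) = 1
    rw [coeff_C_mul, inv_mul_cancel₀ hm]

/-- Proportionality to a reduced triple gives `H = cF`; equality of degrees makes `c` constant, and
the coefficients at `m` give `c = 0`. -/
theorem IsReduced.not_proportional {F H : Fin 3 → Poly} (hred : IsReduced F) {d : ℕ}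
    (hF : ∀ i, (F i).IsHomogeneous d) (hH : ∀ i, (H i).IsHomogeneous d) (hH0 : H ≠ 0)
    {m : Fin 3 →₀ ℕ} (hFm : coeff m (F 0) = 1) (hHm : coeff m (H 0) = 0) :
    ∃ i j, H i * F j ≠ H j * F i := by
  by_contra! h
  obtain ⟨c, hc⟩ := hred.exists_eq_mul h
  apply hH0
  obtain ⟨i, hi⟩ := Function.ne_iff.mp hH0
  have hi' : c * F i ≠ 0 := by rwa [← hc i]
  obtain ⟨k, l, hkl, hck, hFl⟩ := exists_isHomogeneous_of_mul (hc i ▸ hH i) hi'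
  have hl := hFl.inj_right (hF i) (right_ne_zero_of_mul hi')
  obtain rfl : k = 0 := by omega
  have h1 := hc 0
  rw [eq_C_of_isHomogeneous_zero hck] at h1
  rw [h1, coeff_C_mul, hFm, mul_one] at hHm
  funext j
  rw [hc j, eq_C_of_isHomogeneous_zero hck, hHm, map_zero, zero_mul]
  rfl

theorem exists_not_countable_fiber {α β : Type*} [Countable β] {S : Set α} (hS : ¬ S.Countable)
    (φ : α → β) : ∃ b, ¬ {a ∈ S | φ a = b}.Countable := by
  by_contra! h
  refine hS ((Set.countable_iUnion h).mono fun a ha => ?_)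
  rw [Set.mem_iUnion]
  exact ⟨φ a, ha, rfl⟩

/-- An uncountable set of birational maps has a common invariant vector field, for all the
birational maps that commute with it. -/
theorem exists_invariant_vectorField {S : Set Cremona} (hS : ¬ S.Countable) :
    ∃ χ : RationalVectorField, χ ≠ 0 ∧
      ∀ g : Cremona, (∀ f ∈ S, f * g = g * f) → Cremona.pushforward g χ = χ := by
  choose R m hR hred hm using Cremona.exists_normalized
  -- The pairs (degree, normalising monomial) form a countable set, so one of them occurs
  -- uncountably often.
  obtain ⟨⟨d, m₀⟩, hfib⟩ := exists_not_countable_fiber hS fun f => ((R f).degree, m f)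
  set T := {f ∈ S | ((R f).degree, m f) = (d, m₀)} with hT
  have hTd : ∀ f ∈ T, (R f).degree = d := fun f hf => congrArg Prod.fst hf.2
  have hTm : ∀ f ∈ T, m f = m₀ := fun f hf => congrArg Prod.snd hf.2
  have hinj : Set.InjOn (fun f => (R f).coord) T := by
    intro f _ g _ h
    rw [← hR f, ← hR g]
    refine Quotient.sound fun i j => ?_
    have hij : (R f).coord = (R g).coord := h
    rw [hij]
    ring
  have hU : ¬ ((fun f => (R f).coord) '' T).Countable := fun h =>
    hfib (Set.countable_of_injective_of_countable_image hinj h)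
  obtain ⟨_, ⟨f, hf, rfl⟩, H, hH, hH0, hHm, htan⟩ := exists_tangent_triple (d := d) (m₀ := m₀) hU
    (by
      rintro _ ⟨f, hf, rfl⟩ i
      exact hTd f hf ▸ (R f).homogeneous i)
    (by
      rintro _ ⟨f, hf, rfl⟩
      exact hTm f hf ▸ hm f)
  have hH' : ∀ i, (H i).IsHomogeneous (R f).degree := fun i => (hTd f hf).symm ▸ hH i
  obtain ⟨i, j, hij⟩ := (hred f).not_proportional (R f).homogeneous hH' hH0
    (hTm f hf ▸ hm f) hHm
  refine ⟨(R f).tangentField hH', (R f).tangentField_ne_zero hH' hij, fun g hg => ?_⟩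
  have hcomm : ∀ f ∈ S, Cremona.mk (R f) * Cremona.mk (R g)
      = Cremona.mk (R g) * Cremona.mk (R f) := fun f hf => by
    rw [hR, hR]
    exact hg f hf
  have hmain := (R f).pushforward_tangentField hH' (hcomm f hf.1) (htan (R g).coord (by
    rintro _ ⟨f', hf', rfl⟩ i j
    exact Quotient.exact (hcomm f' hf'.1) i j))
  rwa [hR g] at hmain

end CremonaPlane

end

theorem mainTheorem3 (G : Subgroup CremonaPlane.Cremona)
    (hcomm : ∀ f ∈ G, ∀ g ∈ G, f * g = g * f)
    (huncountable : ¬ (G : Set CremonaPlane.Cremona).Countable) :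
    ∃ χ : CremonaPlane.RationalVectorField, χ ≠ 0 ∧
      (∀ f ∈ G, CremonaPlane.Cremona.pushforward f χ = χ) ∧
      ∃ ω : CremonaPlane.Foliation, ω.IsDefinedBy χ ∧ ∀ f ∈ G, ω.IsInvariant f := by
  obtain ⟨χ, hχ, hinv⟩ := CremonaPlane.exists_invariant_vectorField huncountable
  replace hinv : ∀ f ∈ G, CremonaPlane.Cremona.pushforward f χ = χ := fun f hf =>
    hinv f fun g hg => hcomm g hg f hf
  obtain ⟨ω, A, B, p, hB, hp, hA, hω⟩ := CremonaPlane.exists_foliation hχ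
  exact ⟨χ, hχ, hinv, ω, CremonaPlane.Foliation.isDefinedBy_of_chart
    (CremonaPlane.sum_coeff_mul_apply_ratio hB hp hA hω), fun f hf =>
    CremonaPlane.isInvariant_of_pushforward_eq hB hp hA hω (hinv f hf)⟩
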